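/- **Setting.** An *involution channel* is given by two strictly increasing concave functions $\bar\delta_\uparrow:(-\bar\delta_\downarrow^\infty,\infty)\to\mathbb R$ and $\bar\delta_\downarrow:(-\bar\delta_\uparrow^\infty,\infty)\to\mathbb R$ with finite limits $\bar\delta_\uparrow^\infty,\bar\delta_\downarrow^\infty$ at $\infty$ (also written $\bar\delta_{\uparrow/\downarrow}(\infty)$) and $-\bar\delta_\uparrow(-\bar\delta_\downarrow(T))=T$, $-\bar\delta_\downarrow(-\bar\delta_\uparrow(T))=T$ on the respective domains. It is *strictly causal* if $\bar\delta_\uparrow(0)$ and $\bar\delta_\downarrow(0)$ are defined and positive. A *WST signal* is a finite or infinite sequence $(t_n,x_n)_{n\ge0}$ with $t_0=-\infty$, $x_n\in\{0,1\}$ alternating, and $t_n$ strictly increasing and unbounded if the sequence is infinite. A *TCT signal* is a sequence $(t_n,x_n,o_n)_{n\ge 0}$ such that $(t_n,x_n)$ is a WST signal, $o_n\in\mathbb R\cup\{-\infty\}$, $o_0=0$, and the occurrence times $t_n'=t_n+o_n$ satisfy $t'_{n-2}\le t'_n$. Transition $n$ cancels transition $n-1$ if $t_n'\le t_{n-1}'$.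 The state of a signal at time $t$ is the value of its most recent (not canceled) transition occurring at or before $t$. A *CIDM channel* $C$ consists of a $d$-ary Boolean gate $G$, for each input $I$ a pure delay shifter with delays $\Delta_I^+,\Delta_I^-\in\mathbb R$, and an involution channel $\bar\delta_{\uparrow/\downarrow}$. The shifter adds $\Delta_I^+$ ($\Delta_I^-$) to the offsets of rising (falling) transitions, with the two interchanged if $G$ is an inverter; if $G$ is neither an inverter nor a buffer, $\Delta_I^+=\Delta_I^-$ is required. For TCT input signals the channel function yields the following TCT output signal: the gate output is the WST signal that has the fixed initial value $Init(C)$ until time $0$ and, at every $t\ge0$, the value of $G$ on the states of the shifted input signals; its initial transition is given offset $0$, and its $n$-th transition $(t_n,x_n)$, $n\ge1$, is given the offset $\bar\delta_{\uparrow}(t_n-t_{n-1}')$ if $x_n=1$ and $\bar\delta_\downarrow(t_n-t'_{n-1})$ if $x_n=0$. A *circuit* has finitely many input ports and channels, and output ports; every channel input and every output port is fed by exactly one input port or channel, and input ports and channels $\Gamma$ have fixed initial values $Init(\Gamma)$. An *execution* assigns a TCT signal to every vertex such that every channel's signal is its channel function applied to the signals of the vertices feeding it, and every output port has the signal of the vertex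 feeding it. The channels are *compatible* if for every edge from a channel to an input of a channel the logical channel (the involution channel of the former followed by the shifter at that input of the latter, which is again an involution channel) is strictly causal. The externally supplied input port signals are TCT signals with initial values $Init(i)$, transitions $n\ge1$ at times $t_n\ge0$, and they are causal at every channel input they feed: if $p_n$ denotes the occurrence times behind the shifter there, then for all $n\ge1$ either $t_n\le p_n$, or $p_n\le p_{n-1}$ and $t_n\le p_{n-1}$. (This holds, e.g., if all offsets and shifts are $0$.) **Simulation algorithm** with horizon $\tau$. It maintains a file $F(\Gamma)$ of transitions for every input port and channel, and two-valued simulator signals $evTI(\Gamma,I,C)$ and $evGI(I,C)$ for every edge $(\Gamma,I,C)$ into a channel and $evGO(C)$ for every channel. Scheduling a transition of such a signal for time $t$ deletes its transitions already scheduled for times $\ge t$; a scheduled transition that does not change the value of its signal triggers no event; the value of a signal at the current time $t$ takes transitions scheduled for $t$ into account. Initially $F(\Gamma)=((-\infty,Init(\Gamma),0))$, $evTI=0$, $evGI(I,C)=Init(\Gamma)$ for the vertex $\Gamma$ feeding $I$, $evGO(C)=Init(C)$, and $evGO(C)$ is scheduled to change at time $0$ if the gate value on the initial inputs differs from $Init(C)$.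 While the earliest scheduled event has time $t\le\tau$, it is processed; at equal times new external transitions of input ports come first, then $evTI$, then $evGI$, then $evGO$, and remaining ties are broken arbitrarily: - a new external transition of input port $i$ is appended to $F(i)$ and $evTI(i,I,C)$ is toggled at time $t$ on all edges $(i,I,C)$; - $evTI(\Gamma,I,C)$: with $(t_\ast,x,o)$ the last entry of $F(\Gamma)$, schedule $evGI(I,C)$ to become $x$ at time $\max\{t,t_\ast+o+\delta\}$, where $\delta$ is $\Delta_I^+$ or $\Delta_I^-$ according to $x$ (interchanged for an inverter); - $evGI(I,C)$: if the gate value on the current values of $evGI(\cdot,C)$ differs from the value of $evGO(C)$, schedule $evGO(C)$ to take that value at time $t$; - $evGO(C)$ with new value $x$: with $t'$ the occurrence time of the last entry of $F(C)$ and $T=t-t'$, append $(t,x,o)$ to $F(C)$, where $o=\delta_\uparrow(T-\Delta^+)-\Delta^+$ if $x=1$ and $o=\delta_\downarrow(T-\Delta^-)-\Delta^-$ if $x=0$; here $\delta_\uparrow(T)=\Delta^++\bar\delta_\uparrow(T+\Delta^+)$, $\delta_\downarrow(T)=\Delta^-+\bar\delta_\downarrow(T+\Delta^-)$ are the delay functions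 of the channel characterized with a pair $(\Delta^+,\Delta^-)$; and toggle $evTI(C,I,C')$ at time $t$ on all outgoing edges. **Theorem 3 (Correctness of simulation).** For every circuit with compatible CIDM channels, all input port signals as above and every $0\le\tau<\infty$, every run of the simulation algorithm terminates. There is exactly one execution of the circuit with the given input port signals, and when a run has terminated, the file of every input port and channel (for an output port: the file of the vertex feeding it) consists exactly of the transitions of that execution's signal with scheduled time at most $\tau$, in order. -/

import Mathlib

open Set Filter Topology

noncomputable section

namespace CIDM

/-! ### Involution channels

Directions of transitions are Booleans: `true` is rising (`1`), `false` is falling (`0`). -/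

/-- The delay functions of an involution channel. `δ true` is `δ↑` and `δ false` is `δ↓`; they are
only meaningful on their domains `(-δ↓∞, ∞)` and `(-δ↑∞, ∞)`. `lim x` is the finite limit `δ∞` of
`δ x`. -/
structure Involution where
  δ : Bool → ℝ → ℝ
  lim : Bool → ℝ
  strictMono : ∀ x, StrictMonoOn (δ x) (Ioi (-lim (!x)))
  concave : ∀ x, ConcaveOn ℝ (Ioi (-lim (!x))) (δ x)
  tendsto_lim : ∀ x, Tendsto (δ x) atTop (𝓝 (lim x))
  involution : ∀ x T, -lim (!x) < T → -δ (!x) (-δ x T) = T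

/-- Strict causality: `δ↑(0)` and `δ↓(0)` are defined and positive. -/
def Involution.StrictlyCausal (c : Involution) : Prop :=
  ∀ x, 0 ∈ Ioi (-c.lim (!x)) ∧ 0 < c.δ x 0

/-- The delay functions extended to `T = ∞` by their limits. -/
def Involution.delay (c : Involution) (x : Bool) : WithTop ℝ → ℝ
  | ⊤ => c.lim x
  | (T : ℝ) => c.δ x T

/-- The involution channel `c` followed by a pure delay shifter that delays rising transitions by
`a true` and falling ones by `a false`; this is again an involution channel. -/
def Involution.thenShift (c : Involution) (a : Bool → ℝ) : Involution where
  δ x T := a x + c.δ x (T + a (!x))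
  lim x := a x + c.lim x
  strictMono x := by
    intro S hS T hT hST
    simp only [mem_Ioi] at hS hT
    have := c.strictMono x (a := S + a (!x)) (b := T + a (!x))
      (by simp only [mem_Ioi]; linarith) (by simp only [mem_Ioi]; linarith) (by linarith)
    simp only
    linarith
  concave x := by
    have h := (c.concave x).translate_left (a (!x))
    have h2 := (concaveOn_const (𝕜 := ℝ) (a x) h.1).add h
    have hs : (fun z => a (!x) + z) ⁻¹' Ioi (-c.lim (!x)) = Ioi (-(a (!x) + c.lim (!x))) := by
      ext z; simp only [mem_preimage, mem_Ioi]; constructor <;> intro h <;> linarith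
    rw [hs] at h2
    exact h2
  tendsto_lim x :=
    tendsto_const_nhds.add ((c.tendsto_lim x).comp (tendsto_atTop_add_const_right _ _ tendsto_id))
  involution x T hT := by
    have h := c.involution x (T + a (!x)) (by linarith)
    have e : -(a x + c.δ x (T + a (!x))) + a (!!x) = -c.δ x (T + a (!x)) := by
      rw [Bool.not_not]; ring
    rw [e]
    linarith

/-! ### Signals

Both kinds of signals are finite or infinite sequences. Times and offsets live in `ℝ ∪ {-∞}`. -/

/-- The time elapsed at time `t` since `t'`; it is `∞` if `t' = -∞`. -/
def elapsed (t : ℝ) : WithBot ℝ → WithTop ℝ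
  | ⊥ => ⊤
  | (t' : ℝ) => ((t - t' : ℝ) : WithTop ℝ)

/-- Sequences of transitions `(t, x)`. -/
abbrev WSTSeq := Stream'.Seq (WithBot ℝ × Bool)

/-- The conditions for a sequence of transitions to be a WST signal. -/
structure IsWST (w : WSTSeq) : Prop where
  initial : ∃ x, w.get? 0 = some (⊥, x)
  alternating : ∀ n a b, w.get? n = some a → w.get? (n + 1) = some b → b.2 = !a.2
  increasing : ∀ n a b, w.get? n = some a → w.get? (n + 1) = some b → a.1 < b.1
  unbounded : (∀ n, w.get? n ≠ none) → ∀ L : ℝ, ∃ n a, w.get? n = some a ∧ (L : WithBot ℝ) < a.1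

/-- The state function of `w` has value `v` at time `t`: the most recent transition before or at
`t` is to `v`. -/
def WSTState (w : WSTSeq) (t : ℝ) (v : Bool) : Prop :=
  ∃ n s, w.get? n = some (s, v) ∧ s ≤ t ∧ ∀ m > n, ∀ b, w.get? m = some b → (t : WithBot ℝ) < b.1

/-- A transition `(t, x, o)`: scheduled at time `t`, in direction `x`, with offset `o`. -/
structure Transition where
  t : WithBot ℝ
  x : Bool
  o : WithBot ℝ

/-- The time at which a transition actually occurs. -/
def Transition.occ (a : Transition) : WithBot ℝ := a.t + a.o

/-- Sequences of transitions `(t, x, o)`. -/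
abbrev TCTSeq := Stream'.Seq Transition

/-- Forgetting the offsets. -/
def TCTSeq.scheduled (s : TCTSeq) : WSTSeq := s.map fun a => (a.t, a.x)

/-- The conditions for a sequence of transitions with offsets to be a TCT signal. -/
structure IsTCT (s : TCTSeq) : Prop where
  wst : IsWST (TCTSeq.scheduled s)
  offset_zero : ∀ a, s.get? 0 = some a → a.o = 0
  occ_le : ∀ n a b, s.get? n = some a → s.get? (n + 2) = some b → a.occ ≤ b.occ

/-- Transition `n` of `s` is canceled by its successor. -/
def Canceled (s : TCTSeq) (n : ℕ) : Prop :=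
  ∃ a b, s.get? n = some a ∧ s.get? (n + 1) = some b ∧ b.occ ≤ a.occ

/-- The state function of `s` has value `v` at time `t`: this is the value of the most recent not
canceled transition occurring before or at `t`. As a transition that cancels its predecessor may
repeat the value of an earlier transition, even infinitely often before time `t`, "most recent" is
expressed by: some such transition has value `v`, and so have all later ones. -/
def TCTState (s : TCTSeq) (t : ℝ) (v : Bool) : Prop :=
  ∃ n a, s.get? n = some a ∧ a.occ ≤ t ∧ ¬ Canceled s n ∧ a.x = v ∧
    ∀ m > n, ∀ b, s.get? m = some b → b.occ ≤ t → ¬ Canceled s m → b.x = v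

/-- The pure delay shifter: it adds `a x` to the offset of every transition in direction `x`. -/
def shifter (a : Bool → ℝ) (s : TCTSeq) : TCTSeq :=
  s.map fun b => ⟨b.t, b.x, b.o + (a b.x : WithBot ℝ)⟩

/-! ### CIDM channels -/

/-- A CIDM channel that embeds a `d`-ary gate with Boolean function `f`. -/
structure Channel where
  /-- The arity of the embedded gate. -/
  d : ℕ
  /-- The Boolean function of the embedded gate. -/
  f : (Fin d → Bool) → Bool
  /-- The pair `(Δ⁺, Δ⁻)` of the pure delay shifter at each input. -/
  Δ : Fin d → Bool → ℝ
  /-- The involution channel behind the gate. -/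
  inv : Involution
  /-- The pair `(Δ⁺, Δ⁻)` with respect to which the delay functions of the whole channel, from its
  input to its output, are tabulated. -/
  Δchar : Bool → ℝ

namespace Channel

/-- The gate is an inverter. -/
def IsNot (C : Channel) : Prop := C.d = 1 ∧ ∀ v I, C.f v = !(v I)

/-- The gate is a buffer. -/
def IsId (C : Channel) : Prop := C.d = 1 ∧ ∀ v I, C.f v = v I

/-- Delays may depend on the direction only for inverters and buffers. -/
def Supported (C : Channel) : Prop :=
  ¬ C.IsNot → ¬ C.IsId → ∀ I, C.Δ I true = C.Δ I false

open Classical in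
/-- The delay that the shifter at input `I` adds to input transitions in direction `x`. As
`Δ⁺` and `Δ⁻` refer to the directions of the resulting transitions behind the gate, they are
interchanged at an inverter. -/
def inShift (C : Channel) (I : Fin C.d) (x : Bool) : ℝ :=
  if C.IsNot then C.Δ I (!x) else C.Δ I x

/-- The delay functions of the channel from its input to its output, i.e. of a pure delay shifter
`Δchar` followed by the involution channel. -/
def delay (C : Channel) (x : Bool) (T : WithTop ℝ) : ℝ :=
  C.Δchar x + C.inv.delay x (T + (C.Δchar x : WithTop ℝ))

/-- `ug` is the output of the gate with initial value `x₀` if its inputs are the signals that the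
cancellation units produce from `up`. The initial value is kept until the reset is released at
time `0`. -/
structure IsGateOutput (C : Channel) (x₀ : Bool) (up : Fin C.d → TCTSeq) (ug : WSTSeq) : Prop where
  wst : IsWST ug
  initial : ug.get? 0 = some (⊥, x₀)
  nonneg : ∀ n a, ug.get? (n + 1) = some a → ((0 : ℝ) : WithBot ℝ) ≤ a.1
  state : ∀ t : ℝ, 0 ≤ t →
    ∃ v : Fin C.d → Bool, (∀ I, TCTState (up I) t (v I)) ∧ WSTState ug t (C.f v)

/-- `s` is the output of the involution channel for the input `ug`: the transition of `ug` at time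
`t` occurs at the output with delay `δ(t - t')`, where `t'` is the time at which the preceding
transition occurs at the output. -/
structure IsDelayOutput (C : Channel) (ug : WSTSeq) (s : TCTSeq) : Prop where
  scheduled : TCTSeq.scheduled s = ug
  offset_zero : ∀ a, s.get? 0 = some a → a.o = 0
  offset : ∀ n a b (t : ℝ), s.get? n = some a → s.get? (n + 1) = some b → b.t = t →
    b.o = (C.inv.delay b.x (elapsed t a.occ) : ℝ)

/-- The graph of the channel function: `s` is the output of the channel `C` with initial value `x₀`
for the input signals `ui`. -/
def Maps (C : Channel) (x₀ : Bool) (ui : Fin C.d → TCTSeq) (s : TCTSeq) : Prop :=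
  ∃ ug, C.IsGateOutput x₀ (fun I => shifter (C.inShift I) (ui I)) ug ∧ C.IsDelayOutput ug s

end Channel

/-! ### Circuits and executions -/

/-- The vertices of a circuit. -/
inductive Vertex (Inp Out Chan : Type*) where
  | inp (i : Inp)
  | out (o : Out)
  | chan (C : Chan)

/-- A circuit with input ports `Inp`, output ports `Out` and channels `Chan`. Every channel input
and every output port is fed by exactly one input port or channel. -/
structure Circuit (Inp Out Chan : Type*) where
  channel : Chan → Channel
  /-- The vertex that feeds an input of a channel. -/
  src : (Σ C, Fin (channel C).d) → Inp ⊕ Chan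
  /-- The vertex that feeds an output port. -/
  outSrc : Out → Inp ⊕ Chan
  /-- The initial values of input ports and channels. -/
  init : Inp ⊕ Chan → Bool

namespace Circuit

variable {Inp Out Chan : Type*} (N : Circuit Inp Out Chan)

/-- The channel inputs, i.e. the heads of the edges that lead to channels. -/
abbrev Pin : Type _ := Σ C, Fin (N.channel C).d

/-- Input ports and channels as vertices. -/
def toVertex : Inp ⊕ Chan → Vertex Inp Out Chan
  | .inl i => .inp i
  | .inr C => .chan C

/-- The delays of the shifter at a channel input. -/
def pinShift (p : N.Pin) : Bool → ℝ := (N.channel p.1).inShift p.2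

/-- The logical channel between a channel `C` and a channel input `p` fed by `C`. -/
def logical (C : Chan) (p : N.Pin) : Involution :=
  (N.channel C).inv.thenShift (N.pinShift p)

/-- Interconnected channels are compatible: all logical channels are strictly causal. -/
def Compatible : Prop :=
  ∀ (p : N.Pin) (C : Chan), N.src p = .inr C → (N.logical C p).StrictlyCausal

/-- All channels are supported by the simulation algorithm. -/
def Supported : Prop := ∀ C, (N.channel C).Supported

/-- A collection of signals for all vertices is an execution. -/
structure IsExecution (E : Vertex Inp Out Chan → TCTSeq) : Prop where
  tct : ∀ Γ, IsTCT (E Γ)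
  out : ∀ o, E (.out o) = E (toVertex (N.outSrc o))
  chan : ∀ C, (N.channel C).Maps (N.init (.inr C))
    (fun I => E (toVertex (N.src ⟨C, I⟩))) (E (.chan C))

/-- Admissible external signals: TCT signals with the prescribed initial values and all further
transitions scheduled at times `≥ 0`, which are causal at the channel inputs they are connected to:
behind the shifter, a transition occurs before the time it is scheduled at only if it cancels a
transition that has not occurred before that time. -/
structure AdmissibleInput (u : Inp → TCTSeq) : Prop where
  tct : ∀ i, IsTCT (u i)
  init : ∀ i a, (u i).get? 0 = some a → a.x = N.init (.inl i)
  nonneg : ∀ i n a, (u i).get? (n + 1) = some a → ((0 : ℝ) : WithBot ℝ) ≤ a.t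
  causal : ∀ (p : N.Pin) (i : Inp), N.src p = .inl i → ∀ n a b,
    (shifter (N.pinShift p) (u i)).get? n = some a →
    (shifter (N.pinShift p) (u i)).get? (n + 1) = some b →
    b.t ≤ b.occ ∨ (b.occ ≤ a.occ ∧ b.t ≤ a.occ)

end Circuit

/-! ### The simulation algorithm -/

/-- A signal of the event-driven simulator: its current value and the transitions scheduled for it,
in the order of their times. -/
structure Driver where
  cur : Bool
  pend : List (ℝ × Bool)

namespace Driver

open Classical in
/-- `sched(ev, (t, x))`. The new transition replaces those already scheduled for time `t` and cancels
those scheduled for later times. -/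
def sched (D : Driver) (t : ℝ) (x : Bool) : Driver :=
  ⟨D.cur, D.pend.filter (fun e => e.1 < t) ++ [(t, x)]⟩

/-- `sched(ev, (t, toggle))`. -/
def toggle (D : Driver) (t : ℝ) : Driver :=
  D.sched t (!((D.pend.getLast?.map Prod.snd).getD D.cur))

open Classical in
/-- `s(ev, t)` for `t` not in the past: the value of the last transition that has occurred or is
scheduled before or at `t`. -/
def value (D : Driver) (t : ℝ) : Bool :=
  ((D.pend.filter (fun e => e.1 ≤ t)).getLast?.map Prod.snd).getD D.cur

/-- The next scheduled transition takes place. -/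
def advance (D : Driver) : Driver :=
  match D.pend with
  | [] => D
  | (_, x) :: l => ⟨x, l⟩

end Driver

namespace Circuit

variable {Inp Out Chan : Type*} (N : Circuit Inp Out Chan)

/-- The state of the simulation: the files `F(Γ)`, in chronological order, and the signals
`evTI(Γ, I, C)`, `evGI(I, C)` and `evGO(C)`. -/
structure SimState where
  F : Inp ⊕ Chan → List Transition
  ti : N.Pin → Driver
  gi : N.Pin → Driver
  go : Chan → Driver

/-- The events: a new external transition at an input port, `evTI(Γ, I, C)`, `evGI(I, C)` and
`evGO(C)`. -/
inductive Event where
  | ext (i : Inp)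
  | ti (p : N.Pin)
  | gi (p : N.Pin)
  | go (C : Chan)

/-- The order in which events scheduled for the same time occur. -/
def Event.rank : N.Event → ℕ
  | .ext _ => 0
  | .ti _ => 1
  | .gi _ => 2
  | .go _ => 3

/-- The procedure `calcDelta` for the gate of the channel `C`. -/
def calcDelta (C : Channel) (x : Bool) (Δp Δm : ℝ) : ℝ :=
  open Classical in
  if C.IsNot then (if x = true then Δm else Δp)
  else if C.IsId then (if x = true then Δp else Δm)
  else Δp

variable {N}

open Classical in
/-- Initialization: the initial state at time `-∞` and the reset transitions at time `0`. -/
def initState (N : Circuit Inp Out Chan) : N.SimState :=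
  let gi : N.Pin → Driver := fun p => ⟨N.init (N.src p), []⟩
  { F := fun Γ => [⟨⊥, N.init Γ, 0⟩]
    ti := fun _ => ⟨false, []⟩
    gi := gi
    go := fun C =>
      let D : Driver := ⟨N.init (.inr C), []⟩
      let x := (N.channel C).f fun I => (gi ⟨C, I⟩).value 0
      if x ≠ N.init (.inr C) then D.sched 0 x else D }

open Classical in
/-- A new transition is added to `F(Γ)`, and the transition indicators of all edges that leave `Γ`
are toggled. -/
def SimState.emit (st : N.SimState) (Γ : Inp ⊕ Chan) (t : ℝ) (a : Transition) : N.SimState :=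
  { st with
    F := Function.update st.F Γ (st.F Γ ++ [a])
    ti := fun p => if N.src p = Γ then (st.ti p).toggle t else st.ti p }

/-- Processing of `evTI(Γ, I, C)` at time `t`. -/
def SimState.procTI (st : N.SimState) (p : N.Pin) (t : ℝ) : N.SimState :=
  open Classical in
  match (st.F (N.src p)).getLast? with
  | none => st
  | some a =>
    let C := N.channel p.1
    let δmin := calcDelta C a.x (C.Δ p.2 true) (C.Δ p.2 false)
    let t' : ℝ := match a.occ with
      | ⊥ => t
      | (r : ℝ) => max t (r + δmin)
    { st with gi := Function.update st.gi p ((st.gi p).sched t' a.x) }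

/-- Processing of `evGI(I, C)` at time `t`. -/
def SimState.procGI (st : N.SimState) (p : N.Pin) (t : ℝ) : N.SimState :=
  open Classical in
  let C := p.1
  let x := (st.go C).value t
  let y := (N.channel C).f fun I => (st.gi ⟨C, I⟩).value t
  if x ≠ y then { st with go := Function.update st.go C ((st.go C).sched t y) } else st

/-- Processing of `evGO(C)` with value `x` at time `t`. -/
def SimState.procGO (st : N.SimState) (C : Chan) (t : ℝ) (x : Bool) : N.SimState :=
  match (st.F (.inr C)).getLast? with
  | none => st
  | some a =>
    let Δ := (N.channel C).Δchar x
    let T := elapsed t a.occ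
    let o := (N.channel C).delay x (T + ((-Δ : ℝ) : WithTop ℝ)) - Δ
    st.emit (.inr C) t ⟨t, x, (o : ℝ)⟩

variable (N)

/-- The next occurrence of `ev` is scheduled for time `t`. The external signals `u` supply the next
transition of an input port. -/
def Due (u : Inp → TCTSeq) (st : N.SimState) : N.Event → ℝ → Prop
  | .ext i, t => ∃ a, (u i).get? (st.F (.inl i)).length = some a ∧ a.t = t
  | .ti p, t => (st.ti p).pend.head?.map Prod.fst = some t
  | .gi p, t => (st.gi p).pend.head?.map Prod.fst = some t
  | .go C, t => (st.go C).pend.head?.map Prod.fst = some t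

open Classical in
/-- The body of the main loop for the event `ev` at time `t`. A scheduled transition that does not
change the value of its signal is no event and triggers no processing. -/
def process (u : Inp → TCTSeq) (st : N.SimState) (ev : N.Event) (t : ℝ) : N.SimState :=
  match ev with
  | .ext i =>
    match (u i).get? (st.F (.inl i)).length with
    | none => st
    | some a => st.emit (.inl i) t a
  | .ti p =>
    let D := (st.ti p).advance
    let st' : N.SimState := { st with ti := Function.update st.ti p D }
    if D.cur ≠ (st.ti p).cur then st'.procTI p t else st'
  | .gi p =>
    let D := (st.gi p).advance
    let st' : N.SimState := { st with gi := Function.update st.gi p D }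
    if D.cur ≠ (st.gi p).cur then st'.procGI p t else st'
  | .go C =>
    let D := (st.go C).advance
    let st' : N.SimState := { st with go := Function.update st.go C D }
    if D.cur ≠ (st.go C).cur then st'.procGO C t D.cur else st'

/-- One iteration of the main loop with horizon `τ`. The event is any of those that come first in
the order by time and rank; the order of events that agree in both is left open. -/
def Step (u : Inp → TCTSeq) (τ : ℝ) (st st' : N.SimState) : Prop :=
  ∃ ev t, N.Due u st ev t ∧ t ≤ τ ∧
    (∀ ev' t', N.Due u st ev' t' → t < t' ∨ (t = t' ∧ ev.rank ≤ ev'.rank)) ∧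
    st' = N.process u st ev t

/-- The signals recorded by the simulation: the files of input ports and channels, and for an output
port the file of the vertex that feeds it. -/
def SimState.recorded {N : Circuit Inp Out Chan} (st : N.SimState) :
    Vertex Inp Out Chan → List Transition
  | .inp i => st.F (.inl i)
  | .out o => st.F (N.outSrc o)
  | .chan C => st.F (.inr C)

end Circuit

/-- The list `l` consists of exactly the transitions of `s` scheduled up to time `τ`, in order. -/
def IsUpTo (τ : ℝ) (s : TCTSeq) (l : List Transition) : Prop :=
  ∀ n a, l[n]? = some a ↔ s.get? n = some a ∧ a.t ≤ τ

end CIDM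

end

/-!
Strict causality of the finitely many logical channels yields a common margin `ε > 0`: behind a
shifter fed by a channel, a transition scheduled for time `t` has no effect before `t + ε`. Hence
the signals of the channels up to time `t + ε` depend only on the signals up to time `t`. Iterating
the channel functions from any admissible signals, the signals up to any fixed time become
stationary, and the limit is the unique execution.

At every time that the simulation has reached, the files are the initial parts of the signals of
this execution, and the values of `evGI`, present and scheduled, are the states of its shifted
signals restricted to these parts; by the margin they are the true states up to the time of the
next event. Each iteration of the main loop lengthens a file or consumes a scheduled transition, at
the cost only of scheduling transitions for signals of later kinds, and the execution has finitely
many transitions up to the horizon.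
-/

noncomputable section

namespace CIDM

/-! ### WST signals and their state functions -/

/-- The index `k` separates the transitions of `w` that are scheduled up to time `T` from the later
ones. No transition with index `k` needs to exist. -/
def IsCutoff (w : WSTSeq) (T : ℝ) (k : ℕ) : Prop :=
  ∀ n a, w.get? n = some a → (a.1 ≤ T ↔ n < k)

theorem WSTState.unique {w : WSTSeq} {t : ℝ} {v v' : Bool} (h : WSTState w t v)
    (h' : WSTState w t v') : v = v' := by
  obtain ⟨n, s, hn, hs, hmax⟩ := h
  obtain ⟨n', s', hn', hs', hmax'⟩ := h'
  rcases lt_trichotomy n n' with h | rfl | h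
  · exact absurd hs' (hmax _ h _ hn').not_ge
  · exact congrArg Prod.snd (Option.some.inj (hn.symm.trans hn'))
  · exact absurd hs (hmax' _ h _ hn).not_ge

namespace IsWST

variable {w w' : WSTSeq}

theorem lt_of_lt (hw : IsWST w) {n m : ℕ} (h : n < m) {a b} (ha : w.get? n = some a)
    (hb : w.get? m = some b) : a.1 < b.1 := by
  induction m, h using Nat.le_induction generalizing b with
  | base => exact hw.increasing n a b ha hb
  | succ m _ ih =>
    obtain ⟨c, hc⟩ := w.ge_stable m.le_succ hb
    exact (ih hc).trans (hw.increasing m c b hc hb)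

theorem le_of_le (hw : IsWST w) {n m : ℕ} (h : n ≤ m) {a b} (ha : w.get? n = some a)
    (hb : w.get? m = some b) : a.1 ≤ b.1 := by
  rcases h.eq_or_lt with rfl | h
  · rw [Option.some.inj (ha.symm.trans hb)]
  · exact (hw.lt_of_lt h ha hb).le

theorem exists_forall_lt (hw : IsWST w) (T : ℝ) : ∃ n, ∀ a, w.get? n = some a → T < a.1 := by
  by_cases h : ∀ n, w.get? n ≠ none
  · obtain ⟨n, a, ha, hT⟩ := hw.unbounded h T
    exact ⟨n, fun b hb => Option.some.inj (ha.symm.trans hb) ▸ hT⟩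
  · push Not at h
    obtain ⟨n, hn⟩ := h
    exact ⟨n, fun a ha => by simp [hn] at ha⟩

theorem exists_last (hw : IsWST w) (T : ℝ) :
    ∃ n a, w.get? n = some a ∧ a.1 ≤ T ∧ ∀ b, w.get? (n + 1) = some b → T < b.1 := by
  by_contra! h
  have hle : ∀ n, ∃ a, w.get? n = some a ∧ a.1 ≤ T := by
    intro n
    induction n with
    | zero => exact hw.initial.imp' _ fun x hx => ⟨hx, bot_le⟩
    | succ n ih => exact ih.elim fun a ha => h n a ha.1 ha.2
  obtain ⟨n, hn⟩ := hw.exists_forall_lt T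
  obtain ⟨a, ha, haT⟩ := hle n
  exact (hn a ha).not_ge haT

theorem exists_isCutoff (hw : IsWST w) (T : ℝ) : ∃ k, IsCutoff w T k := by
  obtain ⟨n, a, ha, haT, hnext⟩ := hw.exists_last T
  refine ⟨n + 1, fun m b hb => ⟨fun hbT => ?_, fun hm => ?_⟩⟩
  · by_contra! hm
    obtain ⟨c, hc⟩ := w.ge_stable hm hb
    exact (hnext c hc).not_ge ((hw.le_of_le hm hc hb).trans hbT)
  · exact (hw.le_of_le (Nat.lt_succ_iff.1 hm) hb ha).trans haT

theorem isCutoff_pos (hw : IsWST w) {T : ℝ} {k : ℕ} (hk : IsCutoff w T k) : 0 < k := by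
  obtain ⟨x, hx⟩ := hw.initial
  exact (hk 0 _ hx).1 bot_le

theorem state_of_next (hw : IsWST w) {n : ℕ} {a} {t : ℝ} (ha : w.get? n = some a) (hat : a.1 ≤ t)
    (hnext : ∀ b, w.get? (n + 1) = some b → t < b.1) : WSTState w t a.2 := by
  refine ⟨n, a.1, ha, hat, fun m hm b hb => ?_⟩
  obtain ⟨c, hc⟩ := w.ge_stable hm hb
  exact (hnext c hc).trans_le (hw.le_of_le hm hc hb)

theorem state_at (hw : IsWST w) {n : ℕ} {a} {t : ℝ} (ha : w.get? n = some a) (hat : a.1 = t) :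
    WSTState w t a.2 :=
  hw.state_of_next ha hat.le fun b hb => hat ▸ hw.increasing n a b ha hb

theorem exists_next (hw : IsWST w) {n : ℕ} {a} {t : ℝ} {v : Bool} (ha : w.get? n = some a)
    (hat : a.1 ≤ t) (hv : WSTState w t v) (hne : v ≠ a.2) :
    ∃ b, w.get? (n + 1) = some b ∧ b.1 ≤ t := by
  by_contra! h
  exact hne (hv.unique (hw.state_of_next ha hat h))

theorem exists_next_le (hw : IsWST w) (hw' : IsWST w') {n : ℕ} {a b} {t : ℝ}
    (ha : w.get? n = some a) (ha' : w'.get? n = some a) (hb : w.get? (n + 1) = some b)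
    (hbt : b.1 = t) (hs : ∃ v, WSTState w t v ∧ WSTState w' t v) :
    ∃ b', w'.get? (n + 1) = some b' ∧ b'.1 ≤ t := by
  obtain ⟨v, hv, hv'⟩ := hs
  refine hw'.exists_next ha' (hbt ▸ (hw.increasing n a b ha hb).le) hv' ?_
  rw [hv.unique (hw.state_at hb hbt), hw.alternating n a b ha hb]
  exact Bool.not_ne_self _

theorem get?_of_state (hw : IsWST w) (hw' : IsWST w') {T : ℝ} (h0 : w.get? 0 = w'.get? 0)
    (hn : ∀ n a, w.get? (n + 1) = some a → (0 : ℝ) ≤ a.1)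
    (hn' : ∀ n a, w'.get? (n + 1) = some a → (0 : ℝ) ≤ a.1)
    (hs : ∀ t : ℝ, 0 ≤ t → t ≤ T → ∃ v, WSTState w t v ∧ WSTState w' t v) (n : ℕ) :
    ∀ b, w.get? n = some b → b.1 ≤ T → w'.get? n = some b := by
  induction n with
  | zero => exact fun b hb _ => h0 ▸ hb
  | succ n ih =>
    intro b hb hbT
    obtain ⟨a, ha⟩ := w.ge_stable n.le_succ hb
    have ha' := ih a ha ((hw.increasing n a b ha hb).le.trans hbT)
    obtain ⟨t, hbt, ht⟩ := WithBot.coe_le_iff.1 (hn n b hb)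
    have htT : t ≤ T := WithBot.coe_le_coe.1 (hbt ▸ hbT)
    obtain ⟨b', hb', hb't⟩ := hw.exists_next_le hw' ha ha' hb hbt (hs t ht htT)
    obtain ⟨t', hbt', ht'⟩ := WithBot.coe_le_iff.1 (hn' n b' hb')
    have htt' : t' ≤ t := WithBot.coe_le_coe.1 (hbt' ▸ hb't)
    obtain ⟨c, hc, hct'⟩ := hw'.exists_next_le hw ha' ha hb' hbt'
      ((hs t' ht' (htt'.trans htT)).imp fun _ => And.symm)
    obtain rfl := Option.some.inj (hb.symm.trans hc)
    rw [hb', show b' = b from Prod.ext (le_antisymm (hbt ▸ hb't) (hbt' ▸ hct')) <| by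
      rw [hw.alternating n a b ha hb, hw'.alternating n a b' ha' hb']]

end IsWST

/-! ### TCT signals -/

theorem TCTSeq.get?_scheduled (s : TCTSeq) (n : ℕ) :
    (TCTSeq.scheduled s).get? n = (s.get? n).map fun a => (a.t, a.x) :=
  Stream'.Seq.map_get? _ _ _

theorem get?_scheduled_of {s : TCTSeq} {n : ℕ} {a : Transition} (h : s.get? n = some a) :
    (TCTSeq.scheduled s).get? n = some (a.t, a.x) := by
  rw [TCTSeq.get?_scheduled, h, Option.map_some]

theorem exists_of_get?_scheduled {s : TCTSeq} {n : ℕ} {b}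
    (h : (TCTSeq.scheduled s).get? n = some b) : ∃ a, s.get? n = some a ∧ (a.t, a.x) = b :=
  Option.map_eq_some_iff.1 (TCTSeq.get?_scheduled s n ▸ h)

theorem IsWST.t_lt_t {s : TCTSeq} (hs : IsWST (TCTSeq.scheduled s)) {n m : ℕ} (h : n < m)
    {a b : Transition} (ha : s.get? n = some a) (hb : s.get? m = some b) : a.t < b.t :=
  hs.lt_of_lt h (get?_scheduled_of ha) (get?_scheduled_of hb)

theorem IsWST.x_eq_not {s : TCTSeq} (hs : IsWST (TCTSeq.scheduled s)) {n : ℕ} {a b : Transition}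
    (ha : s.get? n = some a) (hb : s.get? (n + 1) = some b) : b.x = !a.x :=
  hs.alternating n _ _ (get?_scheduled_of ha) (get?_scheduled_of hb)

theorem IsWST.x_eq {s : TCTSeq} (hs : IsWST (TCTSeq.scheduled s)) {n : ℕ} {a b : Transition}
    (ha : s.get? n = some a) (hb : s.get? (n + 2) = some b) : b.x = a.x := by
  obtain ⟨m, hm⟩ := s.ge_stable (n + 1).le_succ hb
  rw [hs.x_eq_not hm hb, hs.x_eq_not ha hm, Bool.not_not]

theorem IsCutoff.t_le_iff {s : TCTSeq} {T : ℝ} {k n : ℕ} {a : Transition}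
    (hk : IsCutoff (TCTSeq.scheduled s) T k) (ha : s.get? n = some a) : a.t ≤ T ↔ n < k :=
  hk n _ (get?_scheduled_of ha)

theorem get?_shifter (c : Bool → ℝ) (s : TCTSeq) (n : ℕ) :
    (shifter c s).get? n = (s.get? n).map fun b => ⟨b.t, b.x, b.o + (c b.x : WithBot ℝ)⟩ :=
  Stream'.Seq.map_get? _ _ _

theorem exists_of_get?_shifter {c : Bool → ℝ} {s : TCTSeq} {n : ℕ} {b : Transition}
    (h : (shifter c s).get? n = some b) :
    ∃ a, s.get? n = some a ∧ b.t = a.t ∧ b.x = a.x ∧ b.occ = a.occ + (c a.x : WithBot ℝ) := by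
  rw [get?_shifter] at h
  obtain ⟨a, ha, rfl⟩ := Option.map_eq_some_iff.1 h
  exact ⟨a, ha, rfl, rfl, (add_assoc _ _ _).symm⟩

theorem exists_get?_shifter {c : Bool → ℝ} {s : TCTSeq} {n : ℕ} {a : Transition}
    (h : s.get? n = some a) :
    ∃ b, (shifter c s).get? n = some b ∧ b.t = a.t ∧ b.x = a.x ∧
      b.occ = a.occ + (c a.x : WithBot ℝ) :=
  ⟨⟨a.t, a.x, a.o + (c a.x : WithBot ℝ)⟩, by rw [get?_shifter, h, Option.map_some], rfl, rfl,
    (add_assoc _ _ _).symm⟩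

theorem scheduled_shifter (c : Bool → ℝ) (s : TCTSeq) :
    TCTSeq.scheduled (shifter c s) = TCTSeq.scheduled s := by
  ext1 n
  rw [TCTSeq.get?_scheduled, TCTSeq.get?_scheduled, get?_shifter, Option.map_map]
  rfl

theorem IsWST.exists_get?_zero {s : TCTSeq} (hs : IsWST (TCTSeq.scheduled s))
    (h0 : ∀ a, s.get? 0 = some a → a.o = 0) : ∃ x, s.get? 0 = some ⟨⊥, x, 0⟩ := by
  obtain ⟨x, hx⟩ := hs.initial
  obtain ⟨⟨t, y, o⟩, ha, hax⟩ := exists_of_get?_scheduled hx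
  obtain rfl : o = 0 := h0 _ ha
  obtain rfl : t = ⊥ := congrArg Prod.fst hax
  exact ⟨y, ha⟩

theorem IsTCT.initial {s : TCTSeq} (hs : IsTCT s) : ∃ x, s.get? 0 = some ⟨⊥, x, 0⟩ :=
  hs.wst.exists_get?_zero hs.offset_zero

/-- The properties of TCT signals that survive a shifter. -/
structure IsOrdered (s : TCTSeq) : Prop where
  wst : IsWST (TCTSeq.scheduled s)
  initial : ∃ a, s.get? 0 = some a ∧ a.t = ⊥ ∧ a.occ = ⊥
  occ_le : ∀ n a b, s.get? n = some a → s.get? (n + 2) = some b → a.occ ≤ b.occ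

theorem IsTCT.isOrdered {s : TCTSeq} (hs : IsTCT s) : IsOrdered s where
  wst := hs.wst
  initial := hs.initial.elim fun _ hx => ⟨_, hx, rfl, rfl⟩
  occ_le := hs.occ_le

namespace IsOrdered

variable {s : TCTSeq}

theorem shifter (hs : IsOrdered s) (c : Bool → ℝ) : IsOrdered (shifter c s) where
  wst := (scheduled_shifter c s).symm ▸ hs.wst
  initial := by
    obtain ⟨a, ha, hat, hao⟩ := hs.initial
    obtain ⟨b, hb, hbt, -, hbo⟩ := exists_get?_shifter (c := c) ha
    exact ⟨b, hb, hbt.trans hat, by rw [hbo, hao, WithBot.bot_add]⟩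
  occ_le n a b ha hb := by
    obtain ⟨a', ha', -, -, hao⟩ := exists_of_get?_shifter ha
    obtain ⟨b', hb', -, -, hbo⟩ := exists_of_get?_shifter hb
    rw [hao, hbo, hs.wst.x_eq ha' hb']
    exact add_le_add_left (hs.occ_le n a' b' ha' hb') _

theorem occ_le_or_succ_occ_le (hs : IsOrdered s) {n : ℕ} {a c : Transition} (ha : s.get? n = some a)
    (hc : s.get? (n + 1) = some c) (d : ℕ) :
    ∀ b, s.get? (n + d) = some b → (b.x = a.x ∧ a.occ ≤ b.occ) ∨ (b.x = !a.x ∧ c.occ ≤ b.occ) := by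
  induction d using Nat.twoStepInduction with
  | zero =>
    intro b hb
    obtain rfl := Option.some.inj (ha.symm.trans hb)
    exact .inl ⟨rfl, le_rfl⟩
  | one =>
    intro b hb
    obtain rfl := Option.some.inj (hc.symm.trans hb)
    exact .inr ⟨hs.wst.x_eq_not ha hc, le_rfl⟩
  | more d ih _ =>
    intro b hb
    obtain ⟨e, he⟩ := s.ge_stable (show n + d ≤ n + (d + 2) by lia) hb
    have heb : e.occ ≤ b.occ := hs.occ_le (n + d) e b he hb
    rw [hs.wst.x_eq he hb]
    exact (ih e he).imp (.imp_right heb.trans') (.imp_right heb.trans')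

end IsOrdered

/-! ### State functions of causal TCT signals -/

/-- Every transition occurs at least `ε` after the time it is scheduled at, unless it cancels a
transition that would not have occurred before. For `ε = 0`, this is the causality condition for
external signals; a positive `ε` makes the state up to time `T + ε` independent of the transitions
scheduled after time `T`. -/
def Causal (ε : ℝ) (s : TCTSeq) : Prop :=
  ∀ n (a b : Transition), s.get? n = some a → s.get? (n + 1) = some b →
    b.t + (ε : WithBot ℝ) ≤ b.occ ∨ (b.occ ≤ a.occ ∧ b.t + (ε : WithBot ℝ) ≤ a.occ)

/-- At time `t`, among the first `k` transitions, the last one that is scheduled and occurs before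
or at `t` has value `v`. In contrast to `TCTState`, this is determined by a finite part of `s` and
does not mention cancellations. -/
def PartState (s : TCTSeq) (k : ℕ) (t : ℝ) (v : Bool) : Prop :=
  ∃ n a, n < k ∧ s.get? n = some a ∧ a.x = v ∧ a.t ≤ t ∧ a.occ ≤ t ∧
    ∀ m, n < m → m < k → ∀ b, s.get? m = some b → b.t ≤ t → ¬ b.occ ≤ t

theorem TCTState.unique {s : TCTSeq} {t : ℝ} {v v' : Bool} (h : TCTState s t v)
    (h' : TCTState s t v') : v = v' := by
  obtain ⟨n, a, hn, hs, hc, hv, hmax⟩ := h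
  obtain ⟨n', a', hn', hs', hc', hv', hmax'⟩ := h'
  rcases lt_trichotomy n n' with h | rfl | h
  · rw [← hv', hmax _ h _ hn' hs' hc']
  · rw [← hv, ← hv', Option.some.inj (hn.symm.trans hn')]
  · rw [← hv, hmax' _ h _ hn hs hc]

theorem IsOrdered.tctState_of_next {s : TCTSeq} (hs : IsOrdered s) {n : ℕ} {a : Transition}
    {t : ℝ} (ha : s.get? n = some a) (hat : a.occ ≤ t)
    (hnext : ∀ b, s.get? (n + 1) = some b → t < b.occ) : TCTState s t a.x := by
  refine ⟨n, a, ha, hat, ?_, rfl, fun m hm b hb hbt _ => ?_⟩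
  · rintro ⟨a', b, ha', hb, hba⟩
    obtain rfl := Option.some.inj (ha.symm.trans ha')
    exact (hnext b hb).not_ge (hba.trans hat)
  · obtain ⟨c, hc⟩ := s.ge_stable hm hb
    rcases hs.occ_le_or_succ_occ_le ha hc (m - n) b (by rwa [Nat.add_sub_cancel' hm.le]) with h | h
    · exact h.1
    · exact absurd (h.2.trans hbt) (hnext c hc).not_ge

theorem Causal.lt_occ {ε : ℝ} {s : TCTSeq} (hc : Causal ε s) {n : ℕ} {a b : Transition} {t : ℝ}
    (ha : s.get? n = some a) (hb : s.get? (n + 1) = some b) (hat : a.occ ≤ t)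
    (ht : t < b.t + (ε : WithBot ℝ)) : t < b.occ := by
  rcases hc n a b ha hb with h | h
  · exact ht.trans_le h
  · exact absurd (ht.trans_le (h.2.trans hat)) (lt_irrefl _)

theorem Causal.mono {ε ε' : ℝ} {s : TCTSeq} (hc : Causal ε s) (h : ε' ≤ ε) : Causal ε' s := by
  have hle : ∀ t : WithBot ℝ, t + (ε' : WithBot ℝ) ≤ t + (ε : WithBot ℝ) := fun t =>
    add_le_add_right (WithBot.coe_le_coe.2 h) t
  exact fun n a b ha hb => (hc n a b ha hb).imp (hle b.t).trans (.imp_right (hle b.t).trans)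

theorem IsOrdered.exists_partState {s : TCTSeq} (hs : IsOrdered s) {k : ℕ} (hk : 0 < k) (t : ℝ) :
    ∃ v, PartState s k t v := by
  induction k, hk using Nat.le_induction with
  | base =>
    obtain ⟨a, ha, hat, hao⟩ := hs.initial
    exact ⟨a.x, 0, a, one_pos, ha, rfl, hat ▸ bot_le, hao ▸ bot_le, fun m _ _ => by lia⟩
  | succ k _ ih =>
    by_cases h : ∃ a, s.get? k = some a ∧ a.t ≤ t ∧ a.occ ≤ t
    · obtain ⟨a, ha, hat, hao⟩ := h
      exact ⟨a.x, k, a, k.lt_succ_self, ha, rfl, hat, hao, fun m _ _ => by lia⟩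
    · push Not at h
      obtain ⟨v, n, a, hnk, ha, hv, hat, hao, hmax⟩ := ih
      refine ⟨v, n, a, by lia, ha, hv, hat, hao, fun m hm hmk b hb hbt => ?_⟩
      rcases (Nat.lt_succ_iff.1 hmk).eq_or_lt with rfl | hmk
      · exact (h b hb hbt).not_ge
      · exact hmax m hm hmk b hb hbt

theorem PartState.tctState {s : TCTSeq} (hs : IsOrdered s) {ε : ℝ} (hε : 0 ≤ ε) (hc : Causal ε s)
    {k : ℕ} {t : ℝ} {v : Bool} (h : PartState s k t v)
    (hk : ∀ m ≥ k, ∀ b, s.get? m = some b → t < b.t + (ε : WithBot ℝ)) : TCTState s t v := by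
  obtain ⟨n, a, -, ha, rfl, -, hao, hmax⟩ := h
  refine hs.tctState_of_next ha hao fun b hb => ?_
  by_contra! hbo
  have hbt : t < b.t + (ε : WithBot ℝ) := by
    by_cases hm : n + 1 < k
    · have : t < b.t := not_le.1 fun hbt => hmax _ n.lt_succ_self hm b hb hbt hbo
      exact this.trans_le (le_add_of_nonneg_right (by exact_mod_cast hε))
    · exact hk _ (not_lt.1 hm) b hb
  exact (hc.lt_occ ha hb hao hbt).not_ge hbo

theorem IsCutoff.lt_t_add {s : TCTSeq} {T t ε : ℝ} {k m : ℕ} {b : Transition}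
    (hk : IsCutoff (TCTSeq.scheduled s) T k) (ht : t ≤ T + ε) (hm : k ≤ m)
    (hb : s.get? m = some b) : t < b.t + (ε : WithBot ℝ) := by
  have hT : T < b.t := not_le.1 fun h => ((hk.t_le_iff hb).1 h).not_ge hm
  calc (t : WithBot ℝ) ≤ T + ε := by exact_mod_cast ht
    _ < b.t + ε := WithBot.add_lt_add_right WithBot.coe_ne_bot hT

theorem IsOrdered.exists_tctState {s : TCTSeq} (hs : IsOrdered s) (hc : Causal 0 s) (t : ℝ) :
    ∃ v, TCTState s t v := by
  obtain ⟨k, hk⟩ := hs.wst.exists_isCutoff t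
  obtain ⟨v, hv⟩ := hs.exists_partState (hs.wst.isCutoff_pos hk) t
  exact ⟨v, hv.tctState hs le_rfl hc fun m hm b hb => hk.lt_t_add (add_zero t).ge hm hb⟩

/-- The sequences have the same transitions scheduled up to time `T`. -/
def AgreeUpTo (T : ℝ) (s s' : TCTSeq) : Prop :=
  ∀ n (a : Transition), a.t ≤ T → (s.get? n = some a ↔ s'.get? n = some a)

namespace AgreeUpTo

variable {T : ℝ} {s s' s'' : TCTSeq}

theorem symm (h : AgreeUpTo T s s') : AgreeUpTo T s' s :=
  fun n a ha => (h n a ha).symm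

theorem trans (h : AgreeUpTo T s s') (h' : AgreeUpTo T s' s'') : AgreeUpTo T s s'' :=
  fun n a ha => (h n a ha).trans (h' n a ha)

theorem mono {T' : ℝ} (h : AgreeUpTo T s s') (hT : T' ≤ T) : AgreeUpTo T' s s' :=
  fun n a ha => h n a (ha.trans (WithBot.coe_le_coe.2 hT))

theorem eq_of_forall (h : ∀ T : ℝ, AgreeUpTo T s s') : s = s' := by
  ext n a
  exact h (a.t.unbotD 0) n a (WithBot.le_coe_unbotD _ _)

theorem get?_shifter_of (h : AgreeUpTo T s s') (c : Bool → ℝ) {n : ℕ} {a : Transition}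
    (hat : a.t ≤ T) (ha : (CIDM.shifter c s).get? n = some a) :
    (CIDM.shifter c s').get? n = some a := by
  rw [get?_shifter] at ha ⊢
  obtain ⟨b, hb, rfl⟩ := Option.map_eq_some_iff.1 ha
  rw [(h n b hat).1 hb, Option.map_some]

theorem shifter (h : AgreeUpTo T s s') (c : Bool → ℝ) :
    AgreeUpTo T (shifter c s) (shifter c s') :=
  fun _ _ hat => ⟨h.get?_shifter_of c hat, h.symm.get?_shifter_of c hat⟩

theorem partState (h : AgreeUpTo T s s') {k k' : ℕ} (hk : IsCutoff (TCTSeq.scheduled s) T k)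
    (hk' : IsCutoff (TCTSeq.scheduled s') T k') {t : ℝ} {v : Bool} (hv : PartState s k t v) :
    PartState s' k' t v := by
  obtain ⟨n, a, hnk, ha, hv, hat, hao, hmax⟩ := hv
  have haT : a.t ≤ T := (hk.t_le_iff ha).2 hnk
  have ha' : s'.get? n = some a := (h n a haT).1 ha
  refine ⟨n, a, (hk'.t_le_iff ha').1 haT, ha', hv, hat, hao, fun m hm hmk b hb => ?_⟩
  have hbT : b.t ≤ T := (hk'.t_le_iff hb).2 hmk
  have hb' : s.get? m = some b := (h m b hbT).2 hb
  exact hmax m hm ((hk.t_le_iff hb').1 hbT) b hb'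

theorem exists_tctState (h : AgreeUpTo T s s') {ε t : ℝ} (hs : IsOrdered s) (hs' : IsOrdered s')
    (hε : 0 ≤ ε) (hc : Causal ε s) (hc' : Causal ε s') (ht : t ≤ T + ε) :
    ∃ v, TCTState s t v ∧ TCTState s' t v := by
  obtain ⟨k, hk⟩ := hs.wst.exists_isCutoff T
  obtain ⟨k', hk'⟩ := hs'.wst.exists_isCutoff T
  obtain ⟨v, hv⟩ := hs.exists_partState (hs.wst.isCutoff_pos hk) t
  exact ⟨v, hv.tctState hs hε hc fun m hm b hb => hk.lt_t_add ht hm hb,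
    (h.partState hk hk' hv).tctState hs' hε hc' fun m hm b hb => hk'.lt_t_add ht hm hb⟩

end AgreeUpTo

/-! ### Step functions -/

/-- `g` is a right-continuous step function that changes only at times in the locally finite
set `Q`. -/
structure StepOn (Q : Set ℝ) (g : ℝ → Bool) : Prop where
  finite : ∀ T, (Q ∩ Iic T).Finite
  const : ∀ s t, s ≤ t → (∀ q ∈ Q, s < q → t < q) → g s = g t

/-- The function `g` has the value of the transition `a` from the time of `a` until the next time
in `Q`. -/
def HoldsAfter (Q : Set ℝ) (g : ℝ → Bool) (a : WithBot ℝ × Bool) : Prop :=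
  ∀ t : ℝ, a.1 ≤ t → (∀ q ∈ Q, a.1 < q → t < q) → g t = a.2

open Classical in
/-- The next transition of a signal with state function `g` after the transition `a`. -/
def nextChange (g : ℝ → Bool) (a : WithBot ℝ × Bool) : Option (WithBot ℝ × Bool) :=
  if h : ∃ t, IsLeast {t : ℝ | a.1 < t ∧ g t ≠ a.2} t then some ((h.choose : ℝ), !a.2) else none

/-- The sequence of transitions of a step function with initial value `x₀`. -/
def changes (g : ℝ → Bool) (x₀ : Bool) : WSTSeq :=
  ⟨fun n => Nat.rec (some (⊥, x₀)) (fun _ o => o.bind (nextChange g)) n,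
    fun {_} h => congrArg (Option.bind · (nextChange g)) h⟩

theorem nextChange_eq_some {g : ℝ → Bool} {a b : WithBot ℝ × Bool} (h : nextChange g a = some b) :
    b.2 = (!a.2) ∧ ∃ t : ℝ, b.1 = t ∧ IsLeast {t : ℝ | a.1 < t ∧ g t ≠ a.2} t := by
  unfold nextChange at h
  split_ifs at h with hex
  obtain rfl := Option.some.inj h
  exact ⟨rfl, _, rfl, hex.choose_spec⟩

theorem nextChange_of_isLeast {g : ℝ → Bool} {a : WithBot ℝ × Bool} {t : ℝ}
    (h : IsLeast {t : ℝ | a.1 < t ∧ g t ≠ a.2} t) :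
    nextChange g a = some ((t : WithBot ℝ), !a.2) := by
  have hex : ∃ t, IsLeast {t : ℝ | a.1 < t ∧ g t ≠ a.2} t := ⟨t, h⟩
  rw [nextChange, dif_pos hex, hex.choose_spec.unique h]

theorem changes_zero (g : ℝ → Bool) (x₀ : Bool) : (changes g x₀).get? 0 = some (⊥, x₀) := rfl

theorem changes_succ (g : ℝ → Bool) (x₀ : Bool) (n : ℕ) :
    (changes g x₀).get? (n + 1) = ((changes g x₀).get? n).bind (nextChange g) := rfl

theorem changes_succ_of {g : ℝ → Bool} {x₀ : Bool} {n : ℕ} {a b : WithBot ℝ × Bool}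
    (ha : (changes g x₀).get? n = some a) (hb : (changes g x₀).get? (n + 1) = some b) :
    b.2 = (!a.2) ∧ ∃ t : ℝ, b.1 = t ∧ IsLeast {t : ℝ | a.1 < t ∧ g t ≠ a.2} t := by
  rw [changes_succ, ha, Option.bind_some] at hb
  exact nextChange_eq_some hb

theorem lt_of_changes_succ {g : ℝ → Bool} {x₀ : Bool} {n : ℕ} {a b : WithBot ℝ × Bool}
    (ha : (changes g x₀).get? n = some a) (hb : (changes g x₀).get? (n + 1) = some b) :
    a.1 < b.1 := by
  obtain ⟨-, t, ht, hleast⟩ := changes_succ_of ha hb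
  exact ht ▸ hleast.1.1

namespace StepOn

variable {Q : Set ℝ} {g : ℝ → Bool} {x₀ : Bool} {a : WithBot ℝ × Bool} {t : ℝ}

theorem exists_change_le (h : StepOn Q g) (ha : HoldsAfter Q g a) (ht : a.1 < t) (hg : g t ≠ a.2) :
    ∃ q ∈ Q, a.1 < q ∧ g q ≠ a.2 ∧ q ≤ t := by
  have hne : (Q ∩ Iic t ∩ {q : ℝ | a.1 < q}).Nonempty := by
    by_contra! hempty
    refine hg (ha t ht.le fun q hq haq => ?_)
    by_contra! hqt
    exact hempty.subset ⟨⟨hq, hqt⟩, haq⟩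
  obtain ⟨q, ⟨⟨hq, hqt⟩, haq⟩, hmax⟩ :=
    ((h.finite t).inter_of_left _).exists_maximalFor id _ hne
  have hgq : g q = g t := h.const q t hqt fun r hr hqr => by
    by_contra! hrt
    exact hqr.not_ge (hmax ⟨⟨hr, hrt⟩, haq.trans (WithBot.coe_lt_coe.2 hqr)⟩ hqr.le)
  exact ⟨q, hq, haq, hgq ▸ hg, hqt⟩

theorem exists_isLeast (h : StepOn Q g) (ha : HoldsAfter Q g a) (ht : a.1 < t) (hg : g t ≠ a.2) :
    ∃ q, IsLeast {t : ℝ | a.1 < t ∧ g t ≠ a.2} q := by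
  obtain ⟨q₀, hq₀, haq₀, hgq₀, hq₀t⟩ := h.exists_change_le ha ht hg
  obtain ⟨q, ⟨⟨-, hqt⟩, hqa⟩, hmin⟩ :=
    ((h.finite t).inter_of_left {t : ℝ | a.1 < t ∧ g t ≠ a.2}).exists_minimalFor id _
      ⟨q₀, ⟨hq₀, hq₀t⟩, haq₀, hgq₀⟩
  refine ⟨q, hqa, fun r hr => ?_⟩
  obtain ⟨r', hr', har', hgr', hr'r⟩ := h.exists_change_le ha hr.1 hr.2
  refine le_trans ?_ hr'r
  by_contra! hlt
  exact hlt.not_ge (hmin ⟨⟨hr', hlt.le.trans hqt⟩, har', hgr'⟩ hlt.le)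

theorem holdsAfter_changes (h : StepOn Q g) (h0 : HoldsAfter Q g (⊥, x₀)) {n : ℕ}
    (ha : (changes g x₀).get? n = some a) : HoldsAfter Q g a := by
  cases n with
  | zero => exact Option.some.inj ((changes_zero g x₀).symm.trans ha) ▸ h0
  | succ n =>
    obtain ⟨b, hb⟩ := (changes g x₀).ge_stable n.le_succ ha
    obtain ⟨hx, t, hat, hleast⟩ := changes_succ_of hb ha
    intro r htr hr
    rw [hat] at htr hr
    rw [← h.const t r (WithBot.coe_le_coe.1 htr) fun q hq htq => hr q hq (WithBot.coe_lt_coe.2 htq),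
      hx]
    exact Bool.eq_not.2 hleast.1.2

theorem exists_mem_of_changes_succ (h : StepOn Q g) (h0 : HoldsAfter Q g (⊥, x₀)) {n : ℕ}
    (ha : (changes g x₀).get? (n + 1) = some a) : ∃ q ∈ Q, a.1 = (q : ℝ) := by
  obtain ⟨b, hb⟩ := (changes g x₀).ge_stable n.le_succ ha
  obtain ⟨-, t, hat, hleast⟩ := changes_succ_of hb ha
  obtain ⟨q, hq, hbq, hgq, hqt⟩ :=
    h.exists_change_le (h.holdsAfter_changes h0 hb) hleast.1.1 hleast.1.2
  exact ⟨q, hq, by rw [hat, le_antisymm (hleast.2 ⟨hbq, hgq⟩) hqt]⟩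

theorem unbounded_changes (h : StepOn Q g) (h0 : HoldsAfter Q g (⊥, x₀))
    (hinf : ∀ n, (changes g x₀).get? n ≠ none) (L : ℝ) :
    ∃ n a, (changes g x₀).get? n = some a ∧ L < a.1 := by
  by_contra! hbd
  have hex : ∀ n, ∃ q : ℝ, q ∈ Q ∩ Iic L ∧
      ∃ a, (changes g x₀).get? (n + 1) = some a ∧ a.1 = q := by
    intro n
    obtain ⟨a, ha⟩ := Option.ne_none_iff_exists'.1 (hinf (n + 1))
    obtain ⟨q, hq, haq⟩ := h.exists_mem_of_changes_succ h0 ha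
    exact ⟨q, ⟨hq, WithBot.coe_le_coe.1 (haq ▸ hbd _ a ha)⟩, a, ha, haq⟩
  choose q hq a ha haq using hex
  have hmono : StrictMono q := strictMono_nat_of_lt_succ fun n =>
    WithBot.coe_lt_coe.1 (haq n ▸ haq (n + 1) ▸ lt_of_changes_succ (ha n) (ha (n + 1)))
  exact (h.finite L).not_infinite (infinite_of_injective_forall_mem hmono.injective hq)

theorem isWST_changes (h : StepOn Q g) (h0 : HoldsAfter Q g (⊥, x₀)) : IsWST (changes g x₀) where
  initial := ⟨x₀, rfl⟩
  alternating _ _ _ ha hb := (changes_succ_of ha hb).1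
  increasing _ _ _ ha hb := lt_of_changes_succ ha hb
  unbounded := h.unbounded_changes h0

theorem wstState_changes (h : StepOn Q g) (h0 : HoldsAfter Q g (⊥, x₀)) (t : ℝ) :
    WSTState (changes g x₀) t (g t) := by
  have hw := h.isWST_changes h0
  obtain ⟨n, a, ha, hat, hnext⟩ := hw.exists_last t
  have hold : HoldsAfter Q g a := h.holdsAfter_changes h0 ha
  suffices hg : g t = a.2 from hg ▸ hw.state_of_next ha hat hnext
  by_contra hg
  have hlt : a.1 < t := hat.lt_of_ne fun hat' =>
    hg (hold t hat fun q _ haq => WithBot.coe_lt_coe.1 (hat' ▸ haq))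
  obtain ⟨q, hq⟩ := h.exists_isLeast hold hlt hg
  have hb : (changes g x₀).get? (n + 1) = some ((q : WithBot ℝ), !a.2) := by
    rw [changes_succ, ha, Option.bind_some, nextChange_of_isLeast hq]
  exact (WithBot.coe_lt_coe.1 (hnext _ hb)).not_ge (hq.2 ⟨hlt, hg⟩)

end StepOn

/-! ### The gate output -/

/-- The times at which transitions of `s` have been both scheduled and reached. At all other times,
the state does not change. -/
def changeTimes (s : TCTSeq) : Set ℝ :=
  {q | ∃ n a, s.get? n = some a ∧ max a.t a.occ = q}

theorem IsWST.finite_changeTimes {s : TCTSeq} (hs : IsWST (TCTSeq.scheduled s)) (T : ℝ) :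
    (changeTimes s ∩ Iic T).Finite := by
  obtain ⟨k, hk⟩ := hs.exists_isCutoff T
  refine ((finite_Iio k).image fun n =>
    ((s.get? n).map fun a => (max a.t a.occ).unbotD 0).getD 0).subset ?_
  rintro q ⟨⟨n, a, ha, hq⟩, hqT⟩
  have haT : a.t ≤ T := (le_max_left a.t a.occ).trans (hq ▸ WithBot.coe_le_coe.2 hqT)
  exact ⟨n, (hk.t_le_iff ha).1 haT, by simp [ha, hq]⟩

theorem PartState.of_le {s : TCTSeq} {k : ℕ} {r t : ℝ} {v : Bool} (h : PartState s k r v)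
    (hrt : r ≤ t) (hno : ∀ q ∈ changeTimes s, r < q → t < q) : PartState s k t v := by
  obtain ⟨n, a, hnk, ha, hv, hat, hao, hmax⟩ := h
  have hrt' : (r : WithBot ℝ) ≤ t := WithBot.coe_le_coe.2 hrt
  refine ⟨n, a, hnk, ha, hv, hat.trans hrt', hao.trans hrt', fun m hm hmk b hb hbt hbo => ?_⟩
  have hrb : (r : WithBot ℝ) < max b.t b.occ :=
    not_le.1 fun hle => hmax m hm hmk b hb ((le_max_left _ _).trans hle)
      ((le_max_right _ _).trans hle)
  obtain ⟨q, hq, -⟩ := WithBot.coe_le_iff.1 hrb.le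
  exact (hno q ⟨m, b, hb, hq⟩ (WithBot.coe_lt_coe.1 (hq ▸ hrb))).not_ge
    (WithBot.coe_le_coe.1 (hq ▸ max_le hbt hbo))

theorem IsOrdered.stepOn {s : TCTSeq} (hs : IsOrdered s) (hc : Causal 0 s) {g : ℝ → Bool}
    (hg : ∀ t, TCTState s t (g t)) : StepOn (changeTimes s) g where
  finite := hs.wst.finite_changeTimes
  const r t hrt hno := by
    obtain ⟨k, hk⟩ := hs.wst.exists_isCutoff t
    obtain ⟨v, hv⟩ := hs.exists_partState (hs.wst.isCutoff_pos hk) r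
    have hr : TCTState s r v := hv.tctState hs le_rfl hc fun m hm b hb =>
      hk.lt_t_add (hrt.trans (add_zero t).ge) hm hb
    have ht : TCTState s t v := (hv.of_le hrt hno).tctState hs le_rfl hc fun m hm b hb =>
      hk.lt_t_add (add_zero t).ge hm hb
    rw [(hg r).unique hr, (hg t).unique ht]

/-- The state function of the gate output if the input `I` has the state function `g I`. -/
def Channel.gateState (C : Channel) (x₀ : Bool) (g : Fin C.d → ℝ → Bool) (t : ℝ) : Bool :=
  if t < 0 then x₀ else C.f fun I => g I t

theorem Channel.gateState_of_nonneg (C : Channel) (x₀ : Bool) (g : Fin C.d → ℝ → Bool) {t : ℝ}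
    (ht : 0 ≤ t) : C.gateState x₀ g t = C.f fun I => g I t :=
  if_neg ht.not_gt

theorem StepOn.gateState {C : Channel} {Q : Fin C.d → Set ℝ} {g : Fin C.d → ℝ → Bool}
    (h : ∀ I, StepOn (Q I) (g I)) (x₀ : Bool) :
    StepOn (insert 0 ((⋃ I, Q I) ∩ Ici 0)) (C.gateState x₀ g) where
  finite T := by
    refine ((finite_singleton (0 : ℝ)).union
      (finite_iUnion fun I => (h I).finite T)).subset ?_
    rintro q ⟨rfl | ⟨hq, -⟩, hqT⟩
    · exact .inl rfl
    · obtain ⟨I, hI⟩ := mem_iUnion.1 hq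
      exact .inr (mem_iUnion.2 ⟨I, hI, hqT⟩)
  const s t hst hno := by
    rcases lt_or_ge s 0 with hs | hs
    · have ht : t < 0 := hno 0 (mem_insert _ _) hs
      rw [Channel.gateState, Channel.gateState, if_pos hs, if_pos ht]
    · rw [C.gateState_of_nonneg x₀ g hs, C.gateState_of_nonneg x₀ g (hs.trans hst)]
      congr 1
      ext I
      exact (h I).const s t hst fun q hq hsq =>
        hno q (.inr ⟨mem_iUnion.2 ⟨I, hq⟩, hs.trans hsq.le⟩) hsq

theorem Channel.exists_isGateOutput (C : Channel) (x₀ : Bool) (up : Fin C.d → TCTSeq)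
    (hup : ∀ I, IsOrdered (up I)) (hc : ∀ I, Causal 0 (up I)) : ∃ ug, C.IsGateOutput x₀ up ug := by
  choose g hg using fun I => (hup I).exists_tctState (hc I)
  have hstep := StepOn.gateState (fun I => (hup I).stepOn (hc I) (hg I)) x₀
  have h0 : HoldsAfter (insert 0 ((⋃ I, changeTimes (up I)) ∩ Ici 0)) (C.gateState x₀ g)
      (⊥, x₀) := fun t _ ht => if_pos (ht 0 (mem_insert _ _) (WithBot.bot_lt_coe 0))
  refine ⟨changes (C.gateState x₀ g) x₀, hstep.isWST_changes h0, changes_zero _ _,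
    fun n a ha => ?_, fun t ht => ⟨fun I => g I t, fun I => hg I t, ?_⟩⟩
  · obtain ⟨q, hq, haq⟩ := hstep.exists_mem_of_changes_succ h0 ha
    rw [haq, WithBot.coe_le_coe]
    exact hq.elim (fun h => h.ge) fun h => h.2
  · rw [← C.gateState_of_nonneg x₀ g ht]
    exact hstep.wstState_changes h0 t

/-! ### The involution channel -/

/-- The output transition for the gate transition `b` if the preceding output transition is `a`.
Only the initial gate transition has time `-∞`, and it does not pass through this function. -/
def delayNext (c : Involution) (a : Transition) (b : WithBot ℝ × Bool) : Transition :=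
  ⟨b.1, b.2, match b.1 with
    | ⊥ => 0
    | (t : ℝ) => (c.delay b.2 (elapsed t a.occ) : ℝ)⟩

/-- The output of the involution channel `c` for the input `ug`. -/
def delayed (c : Involution) (ug : WSTSeq) : TCTSeq :=
  ⟨fun n => Nat.rec ((ug.get? 0).map fun b => ⟨b.1, b.2, 0⟩)
    (fun m o => o.bind fun a => (ug.get? (m + 1)).map (delayNext c a)) n,
    fun {n} h => congrArg (Option.bind · fun a => (ug.get? (n + 1)).map (delayNext c a)) h⟩

theorem delayed_zero (c : Involution) (ug : WSTSeq) :
    (delayed c ug).get? 0 = (ug.get? 0).map fun b => ⟨b.1, b.2, 0⟩ := rfl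

theorem delayed_succ (c : Involution) (ug : WSTSeq) (n : ℕ) :
    (delayed c ug).get? (n + 1) =
      ((delayed c ug).get? n).bind fun a => (ug.get? (n + 1)).map (delayNext c a) := rfl

theorem get?_scheduled_delayed (c : Involution) (ug : WSTSeq) (n : ℕ) :
    (TCTSeq.scheduled (delayed c ug)).get? n = ug.get? n := by
  rw [TCTSeq.get?_scheduled]
  induction n with
  | zero => simp only [delayed_zero, Option.map_map, Function.comp_def, Prod.mk.eta, Option.map_id']
  | succ n ih =>
    rw [delayed_succ]
    cases h : ug.get? (n + 1) with
    | none => simp only [Option.map_none, Option.bind_fun_none]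
    | some b =>
      obtain ⟨c, hc⟩ := ug.ge_stable n.le_succ h
      obtain ⟨a, ha, -⟩ := Option.map_eq_some_iff.1 (ih.trans hc)
      simp only [ha, Option.bind_some, Option.map_some, delayNext]

theorem Channel.isDelayOutput_delayed (C : Channel) (ug : WSTSeq) :
    C.IsDelayOutput ug (delayed C.inv ug) where
  scheduled := Stream'.Seq.ext (get?_scheduled_delayed C.inv ug)
  offset_zero a ha := by
    rw [delayed_zero] at ha
    obtain ⟨b, -, rfl⟩ := Option.map_eq_some_iff.1 ha
    rfl
  offset n a b t ha hb ht := by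
    rw [delayed_succ, ha, Option.bind_some] at hb
    obtain ⟨⟨t', x⟩, -, rfl⟩ := Option.map_eq_some_iff.1 hb
    obtain rfl : t' = t := ht
    rfl

namespace Involution

variable {c : Involution} {x : Bool} {T : ℝ}

theorem δ_le_lim (hT : -c.lim (!x) < T) : c.δ x T ≤ c.lim x := by
  refine ge_of_tendsto (c.tendsto_lim x) ?_
  filter_upwards [eventually_ge_atTop T] with S hS
  exact (c.strictMono x).monotoneOn hT (hT.trans_le hS) hS

theorem δ_lt_lim (hT : -c.lim (!x) < T) : c.δ x T < c.lim x :=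
  have hT' : -c.lim (!x) < T + 1 := hT.trans (lt_add_one T)
  (c.strictMono x hT hT' (lt_add_one T)).trans_le (δ_le_lim hT')

theorem neg_lt_δ_not (hT : -c.lim (!x) < T) {S : ℝ} (hS : -c.δ x T < S) : -T < c.δ (!x) S := by
  have hdom : -c.lim (!!x) < -c.δ x T := by
    rw [Bool.not_not]
    exact neg_lt_neg (δ_lt_lim hT)
  have hmono : c.δ (!x) (-c.δ x T) < c.δ (!x) S := c.strictMono (!x) hdom (hdom.trans hS) hS
  linarith [c.involution x T hT]

/-- A quantitative form of strict causality: `ε` is a lower bound of both delay functions even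
at `-ε`. -/
def HasMargin (c : Involution) (ε : ℝ) : Prop :=
  ∀ x, -c.lim (!x) < -ε ∧ ε ≤ c.δ x (-ε)

theorem StrictlyCausal.eventually_hasMargin (h : c.StrictlyCausal) :
    ∀ᶠ ε in 𝓝 (0 : ℝ), c.HasMargin ε := by
  refine eventually_all.2 fun x => ?_
  obtain ⟨h0, hpos⟩ := h x
  have hcont : ContinuousAt (c.δ x) 0 :=
    ((c.concave x).continuousOn isOpen_Ioi).continuousAt (isOpen_Ioi.mem_nhds h0)
  have hneg : Tendsto (fun ε : ℝ => -ε) (𝓝 0) (𝓝 0) := by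
    simpa only [neg_zero] using (continuous_neg (G := ℝ)).tendsto 0
  have hsub : Tendsto (fun ε : ℝ => c.δ x (-ε) - ε) (𝓝 0) (𝓝 (c.δ x 0 - 0)) :=
    (hcont.tendsto.comp hneg).sub tendsto_id
  filter_upwards [hneg.eventually_mem (isOpen_Ioi.mem_nhds h0),
    hsub.eventually_const_lt (by rwa [sub_zero])] with ε hdom hlt
  exact ⟨hdom, (sub_pos.1 hlt).le⟩

theorem HasMargin.le_δ {ε : ℝ} (h : c.HasMargin ε) (hT : -ε ≤ T) : ε ≤ c.δ x T :=
  (h x).2.trans ((c.strictMono x).monotoneOn (h x).1 ((h x).1.trans_le hT) hT)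

theorem HasMargin.le_lim {ε : ℝ} (h : c.HasMargin ε) : ε ≤ c.lim x :=
  (h x).2.trans (δ_le_lim (h x).1)

end Involution

namespace Channel.IsDelayOutput

variable {C : Channel} {ug ug' : WSTSeq} {s s' : TCTSeq}

theorem isWST (h : C.IsDelayOutput ug s) (hw : IsWST ug) : IsWST (TCTSeq.scheduled s) :=
  h.scheduled ▸ hw

theorem exists_get? (h : C.IsDelayOutput ug s) (h' : C.IsDelayOutput ug' s') {n : ℕ} {T : ℝ}
    (hg : ∀ b, ug.get? n = some b → b.1 ≤ T → ug'.get? n = some b) {a : Transition}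
    (ha : s.get? n = some a) (haT : a.t ≤ T) : ∃ o, s'.get? n = some ⟨a.t, a.x, o⟩ := by
  have hb : (TCTSeq.scheduled s').get? n = some (a.t, a.x) := by
    rw [h'.scheduled]
    exact hg _ (h.scheduled ▸ get?_scheduled_of ha) haT
  obtain ⟨⟨t, x, o⟩, hb, hba⟩ := exists_of_get?_scheduled hb
  cases hba
  exact ⟨o, hb⟩

theorem get?_eq (h : C.IsDelayOutput ug s) (h' : C.IsDelayOutput ug' s') (hw : IsWST ug) {T : ℝ}
    (hg : ∀ n a, ug.get? n = some a → a.1 ≤ T → ug'.get? n = some a) (n : ℕ) :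
    ∀ a, s.get? n = some a → a.t ≤ T → s'.get? n = some a := by
  induction n with
  | zero =>
    intro a ha haT
    obtain ⟨o, hb⟩ := h.exists_get? h' (hg 0) ha haT
    have ho : o = a.o := (h'.offset_zero _ hb).trans (h.offset_zero a ha).symm
    rw [hb, ho]
  | succ n ih =>
    intro a ha haT
    obtain ⟨o, hb⟩ := h.exists_get? h' (hg (n + 1)) ha haT
    obtain ⟨c, hc⟩ := s.ge_stable n.le_succ ha
    have hca : c.t < a.t := (h.isWST hw).t_lt_t n.lt_succ_self hc ha
    obtain ⟨t, ht⟩ := WithBot.ne_bot_iff_exists.1 hca.ne_bot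
    have ho : o = _ := h'.offset n c _ t (ih c hc (hca.le.trans haT)) hb ht.symm
    rw [hb, ho, ← h.offset n c a t hc ha ht.symm]

theorem initial (h : C.IsDelayOutput ug s) (hw : IsWST ug) : ∃ x, s.get? 0 = some ⟨⊥, x, 0⟩ :=
  (h.isWST hw).exists_get?_zero h.offset_zero

theorem offset_one (h : C.IsDelayOutput ug s) (hw : IsWST ug) {b : Transition}
    (hb : s.get? 1 = some b) : ∃ t : ℝ, b.t = t ∧ b.o = C.inv.lim b.x := by
  obtain ⟨x, hx⟩ := h.initial hw
  obtain ⟨t, ht⟩ := WithBot.ne_bot_iff_exists.1 ((h.isWST hw).t_lt_t zero_lt_one hx hb).ne_bot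
  exact ⟨t, ht.symm, h.offset 0 _ b t hx hb ht.symm⟩

theorem offset_of_le_lim (h : C.IsDelayOutput ug s) (hw : IsWST ug) {n : ℕ} {a b : Transition}
    (ha : s.get? n = some a) (hb : s.get? (n + 1) = some b) {t o : ℝ} (hat : a.t = t)
    (hao : a.o = o) (ho : o ≤ C.inv.lim a.x) :
    ∃ t' : ℝ, b.t = t' ∧ t < t' ∧ -C.inv.lim (!b.x) < t' - (t + o) ∧
      b.o = C.inv.δ b.x (t' - (t + o)) := by
  have htb : (t : WithBot ℝ) < b.t := hat ▸ (h.isWST hw).t_lt_t n.lt_succ_self ha hb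
  obtain ⟨t', ht'⟩ := WithBot.ne_bot_iff_exists.1 htb.ne_bot
  have htt' : t < t' := WithBot.coe_lt_coe.1 (ht' ▸ htb)
  refine ⟨t', ht'.symm, htt', ?_, ?_⟩
  · rw [(h.isWST hw).x_eq_not ha hb, Bool.not_not]
    linarith
  · rw [h.offset n a b t' ha hb ht'.symm, Transition.occ, hat, hao]
    rfl

theorem offset_le (h : C.IsDelayOutput ug s) (hw : IsWST ug) (n : ℕ) :
    ∀ b, s.get? (n + 1) = some b → ∃ t o : ℝ, b.t = t ∧ b.o = o ∧ o ≤ C.inv.lim b.x := by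
  induction n with
  | zero =>
    intro b hb
    obtain ⟨t, ht, ho⟩ := h.offset_one hw hb
    exact ⟨t, _, ht, ho, le_rfl⟩
  | succ n ih =>
    intro b hb
    obtain ⟨a, ha⟩ := s.ge_stable (n + 1).le_succ hb
    obtain ⟨t, o, hat, hao, ho⟩ := ih a ha
    obtain ⟨t', ht', -, hdom, hbo⟩ := h.offset_of_le_lim hw ha hb hat hao ho
    exact ⟨t', _, ht', hbo, Involution.δ_le_lim hdom⟩

theorem occ_le_occ (h : C.IsDelayOutput ug s) (hw : IsWST ug) {n : ℕ} {a c : Transition}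
    (ha : s.get? n = some a) (hc : s.get? (n + 2) = some c) : a.occ ≤ c.occ := by
  cases n with
  | zero =>
    obtain ⟨x, hx⟩ := h.initial hw
    obtain rfl := Option.some.inj (hx.symm.trans ha)
    exact bot_le
  | succ n =>
    obtain ⟨b, hb⟩ := s.ge_stable (n + 2).le_succ hc
    obtain ⟨t, o, hat, hao, ho⟩ := h.offset_le hw n a ha
    obtain ⟨t₁, hbt, -, hdom, hbo⟩ := h.offset_of_le_lim hw ha hb hat hao ho
    obtain ⟨t₂, hct, hlt, -, hco⟩ :=
      h.offset_of_le_lim hw hb hc hbt hbo (Involution.δ_le_lim hdom)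
    have hδ := Involution.neg_lt_δ_not hdom
      (show -C.inv.δ b.x (t₁ - (t + o)) < t₂ - (t₁ + C.inv.δ b.x (t₁ - (t + o))) by linarith)
    rw [← (h.isWST hw).x_eq_not hb hc] at hδ
    rw [Transition.occ, Transition.occ, hat, hao, hct, hco]
    norm_cast
    linarith

theorem isTCT (h : C.IsDelayOutput ug s) (hw : IsWST ug) : IsTCT s :=
  ⟨h.isWST hw, h.offset_zero, fun _ _ _ => h.occ_le_occ hw⟩

theorem causal (h : C.IsDelayOutput ug s) (hw : IsWST ug) {c : Bool → ℝ} {ε : ℝ}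
    (hε : (C.inv.thenShift c).HasMargin ε) : Causal ε (shifter c s) := by
  intro n a' b' ha' hb'
  obtain ⟨a, ha, -, -, hao'⟩ := exists_of_get?_shifter ha'
  obtain ⟨b, hb, hbt', -, hbo'⟩ := exists_of_get?_shifter hb'
  rw [hao', hbt', hbo']
  cases n with
  | zero =>
    obtain ⟨t, ht, ho⟩ := h.offset_one hw hb
    have hlim : ε ≤ c b.x + C.inv.lim b.x := hε.le_lim
    rw [Transition.occ, ht, ho]
    norm_cast
    left
    linarith
  | succ n =>
    obtain ⟨t, o, hat, hao, ho⟩ := h.offset_le hw n a ha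
    obtain ⟨t', hbt, -, -, hbo⟩ := h.offset_of_le_lim hw ha hb hat hao ho
    have hax : a.x = !b.x := by rw [(h.isWST hw).x_eq_not ha hb, Bool.not_not]
    have hδ : -ε ≤ t' - (t + o) - c (!b.x) → ε ≤ c b.x + C.inv.δ b.x (t' - (t + o)) := fun hT => by
      simpa only [Involution.thenShift, sub_add_cancel] using hε.le_δ (x := b.x) hT
    rw [Transition.occ, Transition.occ, hat, hao, hbt, hbo, hax]
    norm_cast
    rcases le_or_gt ε (c b.x + C.inv.δ b.x (t' - (t + o))) with hle | hlt
    · left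
      linarith
    · have hT : t' - (t + o) - c (!b.x) < -ε := not_le.1 fun hT => hlt.not_ge (hδ hT)
      exact .inr ⟨by linarith, by linarith⟩

end Channel.IsDelayOutput

/-! ### Limits of sequences of signals -/

section Limit

variable {r : ℕ → ℝ} {S : ℕ → TCTSeq} {s : TCTSeq}

theorem AgreeUpTo.of_le (hr : Monotone r) (hS : ∀ k, AgreeUpTo (r k) (S k) (S (k + 1))) {j k : ℕ}
    (h : j ≤ k) : AgreeUpTo (r j) (S j) (S k) := by
  induction k, h using Nat.le_induction with
  | base => exact fun _ _ _ => Iff.rfl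
  | succ k hk ih => exact ih.trans ((hS k).mono (hr hk))

theorem AgreeUpTo.get?_iff_of_le (hr : Monotone r)
    (hS : ∀ k, AgreeUpTo (r k) (S k) (S (k + 1))) {j k n : ℕ} {a : Transition}
    (hj : a.t ≤ r j) (hk : a.t ≤ r k) : (S j).get? n = some a ↔ (S k).get? n = some a := by
  rcases le_total j k with h | h
  · exact of_le hr hS h n a hj
  · exact (of_le hr hS h n a hk).symm

/-- The transition `a` is the `n`-th one of some `S k`, and at a time at which all later signals of
the sequence agree with `S k`. -/
def IsStable (r : ℕ → ℝ) (S : ℕ → TCTSeq) (n : ℕ) (a : Transition) : Prop :=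
  ∃ k, (S k).get? n = some a ∧ a.t ≤ r k

theorem IsStable.unique (hr : Monotone r) (hS : ∀ k, AgreeUpTo (r k) (S k) (S (k + 1))) {n : ℕ}
    {a b : Transition} (ha : IsStable r S n a) (hb : IsStable r S n b) : a = b := by
  obtain ⟨j, hj, haj⟩ := ha
  obtain ⟨k, hk, hbk⟩ := hb
  rcases le_total j k with h | h
  · exact Option.some.inj (((AgreeUpTo.of_le hr hS h n a haj).1 hj).symm.trans hk)
  · exact Option.some.inj (hj.symm.trans ((AgreeUpTo.of_le hr hS h n b hbk).1 hk))

theorem IsStable.exists_pred (hw : ∀ k, IsWST (TCTSeq.scheduled (S k))) {n : ℕ} {a : Transition}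
    (ha : IsStable r S (n + 1) a) : ∃ b, IsStable r S n b := by
  obtain ⟨k, hk, hak⟩ := ha
  obtain ⟨b, hb⟩ := (S k).ge_stable n.le_succ hk
  exact ⟨b, k, hb, ((hw k).t_lt_t n.lt_succ_self hb hk).le.trans hak⟩

open Classical in
theorem exists_get?_eq_some_iff_isStable (hr : Monotone r)
    (hS : ∀ k, AgreeUpTo (r k) (S k) (S (k + 1))) (hw : ∀ k, IsWST (TCTSeq.scheduled (S k))) :
    ∃ s : TCTSeq, ∀ n a, s.get? n = some a ↔ IsStable r S n a := by
  let f : ℕ → Option Transition := fun n =>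
    if h : ∃ a, IsStable r S n a then some h.choose else none
  have hf : ∀ n, f n = none ↔ ¬ ∃ a, IsStable r S n a := fun n => by
    simp only [f, dite_eq_right_iff, reduceCtorEq, imp_false]
  refine ⟨⟨f, fun {n} hn => (hf _).2 fun ⟨a, ha⟩ => (hf n).1 hn (ha.exists_pred hw)⟩,
    fun n a => ?_⟩
  change f n = some a ↔ _
  by_cases h : ∃ a, IsStable r S n a
  · simp only [f, dif_pos h, Option.some.injEq]
    exact ⟨fun e => e ▸ h.choose_spec, h.choose_spec.unique hr hS⟩
  · simp only [f, dif_neg h, reduceCtorEq, false_iff]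
    exact fun ha => h ⟨a, ha⟩

theorem exists_limit (hr : Monotone r) (hS : ∀ k, AgreeUpTo (r k) (S k) (S (k + 1)))
    (hw : ∀ k, IsWST (TCTSeq.scheduled (S k))) : ∃ s, ∀ k, AgreeUpTo (r k) (S k) s := by
  obtain ⟨s, hs⟩ := exists_get?_eq_some_iff_isStable hr hS hw
  refine ⟨s, fun k n a hak => ?_⟩
  rw [hs]
  exact ⟨fun h => ⟨k, h, hak⟩, fun ⟨j, hj, haj⟩ => (AgreeUpTo.get?_iff_of_le hr hS haj hak).1 hj⟩

theorem eventually_get?_eq (hr : Tendsto r atTop atTop) (h : ∀ k, AgreeUpTo (r k) (S k) s)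
    {n : ℕ} {a : Transition} (ha : s.get? n = some a) : ∀ᶠ k in atTop, (S k).get? n = some a := by
  filter_upwards [hr.eventually_ge_atTop (a.t.unbotD 0)] with k hk
  exact (h k n a ((WithBot.le_coe_unbotD _ _).trans (WithBot.coe_le_coe.2 hk))).2 ha

theorem exists_get?_eq_of_limit (hr : Tendsto r atTop atTop) (h : ∀ k, AgreeUpTo (r k) (S k) s)
    {n m : ℕ} {a b : Transition} (ha : s.get? n = some a) (hb : s.get? m = some b) :
    ∃ k, (S k).get? n = some a ∧ (S k).get? m = some b :=
  ((eventually_get?_eq hr h ha).and (eventually_get?_eq hr h hb)).exists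

theorem isWST_of_limit (hr : Tendsto r atTop atTop) (hw : ∀ k, IsWST (TCTSeq.scheduled (S k)))
    (h : ∀ k, AgreeUpTo (r k) (S k) s) : IsWST (TCTSeq.scheduled s) where
  initial := by
    obtain ⟨x, hx⟩ := (hw 0).initial
    obtain ⟨a, ha, hax⟩ := exists_of_get?_scheduled hx
    have hat : a.t = ⊥ := congrArg Prod.fst hax
    exact ⟨x, hax ▸ get?_scheduled_of ((h 0 0 a (hat ▸ bot_le)).1 ha)⟩
  alternating n a b ha hb := by
    obtain ⟨a, ha', rfl⟩ := exists_of_get?_scheduled ha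
    obtain ⟨b, hb', rfl⟩ := exists_of_get?_scheduled hb
    obtain ⟨k, hak, hbk⟩ := exists_get?_eq_of_limit hr h ha' hb'
    exact (hw k).x_eq_not hak hbk
  increasing n a b ha hb := by
    obtain ⟨a, ha', rfl⟩ := exists_of_get?_scheduled ha
    obtain ⟨b, hb', rfl⟩ := exists_of_get?_scheduled hb
    obtain ⟨k, hak, hbk⟩ := exists_get?_eq_of_limit hr h ha' hb'
    exact (hw k).t_lt_t n.lt_succ_self hak hbk
  unbounded hinf L := by
    by_contra! hbd
    obtain ⟨k, hk⟩ := (hr.eventually_ge_atTop L).exists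
    obtain ⟨m, hm⟩ := (hw k).exists_isCutoff L
    obtain ⟨b, hb⟩ := Option.ne_none_iff_exists'.1 (hinf m)
    obtain ⟨a, ha, rfl⟩ := exists_of_get?_scheduled hb
    have haL : a.t ≤ L := hbd m _ hb
    have hak := (h k m a (haL.trans (WithBot.coe_le_coe.2 hk))).2 ha
    exact lt_irrefl m ((hm.t_le_iff hak).1 haL)

theorem isTCT_of_limit (hr : Tendsto r atTop atTop) (hS : ∀ k, IsTCT (S k))
    (h : ∀ k, AgreeUpTo (r k) (S k) s) : IsTCT s where
  wst := isWST_of_limit hr (fun k => (hS k).wst) h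
  offset_zero a ha := by
    obtain ⟨k, hk⟩ := (eventually_get?_eq hr h ha).exists
    exact (hS k).offset_zero a hk
  occ_le n a b ha hb := by
    obtain ⟨k, ha, hb⟩ := exists_get?_eq_of_limit hr h ha hb
    exact (hS k).occ_le n a b ha hb

theorem Causal.of_limit (hr : Tendsto r atTop atTop) {ε : ℝ} (hc : ∀ k, Causal ε (S k))
    (h : ∀ k, AgreeUpTo (r k) (S k) s) : Causal ε s := by
  intro n a b ha hb
  obtain ⟨k, ha, hb⟩ := exists_get?_eq_of_limit hr h ha hb
  exact hc k n a b ha hb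

end Limit

/-! ### Signals of a circuit -/

/-- The properties that the outputs of all gates with initial value `x₀` have in common. -/
structure IsGateSignal (x₀ : Bool) (ug : WSTSeq) : Prop where
  wst : IsWST ug
  initial : ug.get? 0 = some (⊥, x₀)
  nonneg : ∀ n a, ug.get? (n + 1) = some a → ((0 : ℝ) : WithBot ℝ) ≤ a.1

theorem Channel.IsGateOutput.isGateSignal {C : Channel} {x₀ : Bool} {up : Fin C.d → TCTSeq}
    {ug : WSTSeq} (h : C.IsGateOutput x₀ up ug) : IsGateSignal x₀ ug :=
  ⟨h.wst, h.initial, h.nonneg⟩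

theorem isGateSignal_changes_const (x₀ : Bool) : IsGateSignal x₀ (changes (fun _ => x₀) x₀) :=
  have hstep : StepOn ∅ fun _ => x₀ := ⟨fun T => by simp only [empty_inter, finite_empty],
    fun _ _ _ _ => rfl⟩
  have h0 : HoldsAfter ∅ (fun _ => x₀) (⊥, x₀) := fun _ _ _ => rfl
  ⟨hstep.isWST_changes h0, changes_zero _ _, fun _ _ ha =>
    (hstep.exists_mem_of_changes_succ h0 ha).elim fun _ hq => hq.1.elim⟩

theorem Channel.IsDelayOutput.get?_zero {C : Channel} {x₀ : Bool} {ug : WSTSeq} {s : TCTSeq}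
    (h : C.IsDelayOutput ug s) (hg : IsGateSignal x₀ ug) : s.get? 0 = some ⟨⊥, x₀, 0⟩ := by
  obtain ⟨x, hx⟩ := h.initial hg.wst
  have hx' : ug.get? 0 = some (⊥, x) := h.scheduled ▸ get?_scheduled_of hx
  obtain rfl : x = x₀ := congrArg Prod.snd (Option.some.inj (hx'.symm.trans hg.initial))
  exact hx

namespace Circuit

variable {Inp Out Chan : Type*} (N : Circuit Inp Out Chan)

/-- The signal behind the shifter at a channel input. -/
def pinSignal (W : Inp ⊕ Chan → TCTSeq) (p : N.Pin) : TCTSeq :=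
  shifter (N.pinShift p) (W (N.src p))

/-- The lookahead at a channel input: `ε` if it is fed by a channel, and `0` if it is fed by an
input port. -/
def pinLag (ε : ℝ) (p : N.Pin) : ℝ := Sum.elim (fun _ => 0) (fun _ => ε) (N.src p)

theorem pinLag_nonneg {ε : ℝ} (hε : 0 ≤ ε) (p : N.Pin) : 0 ≤ N.pinLag ε p := by
  unfold pinLag
  cases N.src p with
  | inl i => exact le_rfl
  | inr C => exact hε

/-- All logical channels are strictly causal with the common margin `ε`. -/
def HasMargin (ε : ℝ) : Prop :=
  ∀ p C, N.src p = .inr C → (N.logical C p).HasMargin ε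

theorem Compatible.exists_hasMargin {N : Circuit Inp Out Chan} [Finite Chan] (h : N.Compatible) :
    ∃ ε > 0, N.HasMargin ε := by
  have hp : ∀ p : N.Pin, ∀ᶠ ε in 𝓝[>] (0 : ℝ), ∀ C, N.src p = .inr C →
      (N.logical C p).HasMargin ε := by
    intro p
    cases hsrc : N.src p with
    | inl i => exact .of_forall fun _ _ hC => nomatch hC
    | inr C =>
      filter_upwards [(h p C hsrc).eventually_hasMargin.filter_mono nhdsWithin_le_nhds]
        with ε hε C' hC'
      exact Sum.inr.inj hC' ▸ hε
  obtain ⟨ε, hε, hpos⟩ := ((eventually_all.2 hp).and self_mem_nhdsWithin).exists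
  exact ⟨ε, hpos, hε⟩

/-- The properties of the signals of input ports and channels that do not depend on the functions
of the gates; in particular, the signals are causal at the channel inputs. The input ports have the
signals `u`. -/
structure IsSignals (u : Inp → TCTSeq) (ε : ℝ) (W : Inp ⊕ Chan → TCTSeq) : Prop where
  inl : ∀ i, W (.inl i) = u i
  tct : ∀ Γ, IsTCT (W Γ)
  init : ∀ Γ, (W Γ).get? 0 = some ⟨⊥, N.init Γ, 0⟩
  nonneg : ∀ Γ n a, (W Γ).get? (n + 1) = some a → ((0 : ℝ) : WithBot ℝ) ≤ a.t
  causal : ∀ p, Causal (N.pinLag ε p) (N.pinSignal W p)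

/-- The channels map the signals `W` to the signals `W'`. -/
def MapsTo (W W' : Inp ⊕ Chan → TCTSeq) : Prop :=
  ∀ C, (N.channel C).Maps (N.init (.inr C)) (fun I => W (N.src ⟨C, I⟩)) (W' (.inr C))

variable {N} {u : Inp → TCTSeq} {ε : ℝ} {W W' W₁ W₂ W₁' W₂' : Inp ⊕ Chan → TCTSeq}

theorem AdmissibleInput.causal_pinSignal (hu : N.AdmissibleInput u) (hW : ∀ i, W (.inl i) = u i)
    {p : N.Pin} {i : Inp} (hp : N.src p = .inl i) :
    Causal (N.pinLag ε p) (N.pinSignal W p) := by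
  intro n a b ha hb
  rw [pinSignal, hp, hW] at ha hb
  rw [pinLag, hp, Sum.elim_inl, WithBot.coe_zero, add_zero]
  exact hu.causal p i hp n a b ha hb

theorem AdmissibleInput.get?_zero (hu : N.AdmissibleInput u) (i : Inp) :
    (u i).get? 0 = some ⟨⊥, N.init (.inl i), 0⟩ := by
  obtain ⟨x, hx⟩ := (hu.tct i).initial
  rw [hx, ← hu.init i _ hx]

theorem isSignals_of_isDelayOutput (hu : N.AdmissibleInput u) (hε : N.HasMargin ε)
    (hW : ∀ i, W (.inl i) = u i)
    (h : ∀ C, ∃ ug, IsGateSignal (N.init (.inr C)) ug ∧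
      (N.channel C).IsDelayOutput ug (W (.inr C))) : N.IsSignals u ε W := by
  choose ug hg hd using h
  refine ⟨hW, ?_, ?_, ?_, fun p => ?_⟩
  · rintro (i | C)
    · exact hW i ▸ hu.tct i
    · exact (hd C).isTCT (hg C).wst
  · rintro (i | C)
    · exact hW i ▸ hu.get?_zero i
    · exact (hd C).get?_zero (hg C)
  · rintro (i | C) n a ha
    · exact hu.nonneg i n a (hW i ▸ ha)
    · exact (hg C).nonneg n _ ((hd C).scheduled ▸ get?_scheduled_of ha)
  · cases hp : N.src p with
    | inl i => exact hu.causal_pinSignal hW hp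
    | inr C =>
      have hc := (hd C).causal (hg C).wst (hε p C hp)
      rwa [← hp, show ε = N.pinLag ε p by rw [pinLag, hp, Sum.elim_inr]] at hc

theorem MapsTo.isSignals (hm : N.MapsTo W W') (hu : N.AdmissibleInput u) (hε : N.HasMargin ε)
    (hW' : ∀ i, W' (.inl i) = u i) : N.IsSignals u ε W' :=
  isSignals_of_isDelayOutput hu hε hW' fun C =>
    (hm C).imp fun _ h => ⟨h.1.isGateSignal, h.2⟩

theorem exists_isSignals (hu : N.AdmissibleInput u) (hε : N.HasMargin ε) :
    ∃ W : Inp ⊕ Chan → TCTSeq, N.IsSignals u ε W :=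
  ⟨Sum.elim u fun C => delayed (N.channel C).inv
      (changes (fun _ => N.init (.inr C)) (N.init (.inr C))),
    isSignals_of_isDelayOutput hu hε (fun _ => rfl) fun C =>
      ⟨_, isGateSignal_changes_const _, (N.channel C).isDelayOutput_delayed _⟩⟩

namespace IsSignals

theorem isOrdered (hW : N.IsSignals u ε W) (p : N.Pin) : IsOrdered (N.pinSignal W p) :=
  (hW.tct _).isOrdered.shifter _

theorem exists_mapsTo (hW : N.IsSignals u ε W) (hu : N.AdmissibleInput u) (hε0 : 0 ≤ ε)
    (hε : N.HasMargin ε) : ∃ W', N.IsSignals u ε W' ∧ N.MapsTo W W' := by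
  choose ug hug using fun C => (N.channel C).exists_isGateOutput (N.init (.inr C))
    (fun I => N.pinSignal W ⟨C, I⟩) (fun I => hW.isOrdered ⟨C, I⟩)
    fun I => (hW.causal ⟨C, I⟩).mono (N.pinLag_nonneg hε0 ⟨C, I⟩)
  have hm : N.MapsTo W (Sum.elim u fun C => delayed (N.channel C).inv (ug C)) := fun C =>
    ⟨ug C, hug C, (N.channel C).isDelayOutput_delayed (ug C)⟩
  exact ⟨_, hm.isSignals hu hε fun _ => rfl, hm⟩

theorem agreeUpTo_neg_one (h₁ : N.IsSignals u ε W₁) (h₂ : N.IsSignals u ε W₂) (Γ : Inp ⊕ Chan) :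
    AgreeUpTo (-1) (W₁ Γ) (W₂ Γ) := by
  intro n a ha
  cases n with
  | zero => rw [h₁.init, h₂.init]
  | succ n =>
    have hneg : ¬ (0 : ℝ) ≤ a.t := fun h => by
      linarith [WithBot.coe_le_coe.1 (h.trans ha)]
    exact ⟨fun h => absurd (h₁.nonneg Γ n a h) hneg, fun h => absurd (h₂.nonneg Γ n a h) hneg⟩

theorem exists_tctState_pinSignal (h₁ : N.IsSignals u ε W₁) (h₂ : N.IsSignals u ε W₂) (hε : 0 ≤ ε)
    {T t : ℝ} (h : ∀ Γ, AgreeUpTo T (W₁ Γ) (W₂ Γ)) (ht : t ≤ T + ε) (p : N.Pin) :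
    ∃ v, TCTState (N.pinSignal W₁ p) t v ∧ TCTState (N.pinSignal W₂ p) t v := by
  cases hsrc : N.src p with
  | inl i =>
    have heq : N.pinSignal W₁ p = N.pinSignal W₂ p := by
      rw [pinSignal, pinSignal, hsrc, h₁.inl, h₂.inl]
    obtain ⟨v, hv⟩ := (h₁.isOrdered p).exists_tctState
      ((h₁.causal p).mono (N.pinLag_nonneg hε p)) t
    exact ⟨v, hv, heq ▸ hv⟩
  | inr D =>
    have hlag : N.pinLag ε p = ε := by rw [pinLag, hsrc, Sum.elim_inr]
    exact ((h (N.src p)).shifter (N.pinShift p)).exists_tctState (h₁.isOrdered p)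
      (h₂.isOrdered p) hε (hlag ▸ h₁.causal p) (hlag ▸ h₂.causal p) ht

theorem get?_of_mapsTo (h₁ : N.IsSignals u ε W₁) (h₂ : N.IsSignals u ε W₂) (hε : 0 ≤ ε)
    (hm₁ : N.MapsTo W₁ W₁') (hm₂ : N.MapsTo W₂ W₂') {T : ℝ}
    (h : ∀ Γ, AgreeUpTo T (W₁ Γ) (W₂ Γ)) (C : Chan) (n : ℕ) (a : Transition)
    (ha : (W₁' (.inr C)).get? n = some a) (haT : a.t ≤ ((T + ε : ℝ) : WithBot ℝ)) :
    (W₂' (.inr C)).get? n = some a := by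
  obtain ⟨ug₁, hg₁, hd₁⟩ := hm₁ C
  obtain ⟨ug₂, hg₂, hd₂⟩ := hm₂ C
  refine hd₁.get?_eq hd₂ hg₁.wst (hg₁.wst.get?_of_state hg₂.wst
    (hg₁.initial.trans hg₂.initial.symm) hg₁.nonneg hg₂.nonneg fun t ht htT => ?_) n a ha haT
  obtain ⟨v₁, hv₁, hs₁⟩ := hg₁.state t ht
  obtain ⟨v₂, hv₂, hs₂⟩ := hg₂.state t ht
  have hv : v₁ = v₂ := by
    funext I
    obtain ⟨v, hv, hv'⟩ := h₁.exists_tctState_pinSignal h₂ hε h htT ⟨C, I⟩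
    exact ((hv₁ I).unique hv).trans (hv'.unique (hv₂ I))
  exact ⟨_, hs₁, hv ▸ hs₂⟩

/-- This is the contraction property of the channel functions: the signals at channel inputs fed by
channels determine the gate states for the time `ε` beyond the time up to which they are known. -/
theorem agreeUpTo_add (h₁ : N.IsSignals u ε W₁) (h₂ : N.IsSignals u ε W₂) (hε : 0 ≤ ε)
    (h₁' : N.IsSignals u ε W₁') (h₂' : N.IsSignals u ε W₂') (hm₁ : N.MapsTo W₁ W₁')
    (hm₂ : N.MapsTo W₂ W₂') {T : ℝ} (h : ∀ Γ, AgreeUpTo T (W₁ Γ) (W₂ Γ)) (Γ : Inp ⊕ Chan) :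
    AgreeUpTo (T + ε) (W₁' Γ) (W₂' Γ) := by
  cases Γ with
  | inl i =>
    rw [h₁'.inl, h₂'.inl]
    exact fun _ _ _ => Iff.rfl
  | inr C =>
    exact fun n a ha => ⟨fun hn => h₁.get?_of_mapsTo h₂ hε hm₁ hm₂ h C n a hn ha,
      fun hn => h₂.get?_of_mapsTo h₁ hε hm₂ hm₁ (fun Γ => (h Γ).symm) C n a hn ha⟩

theorem of_limit {r : ℕ → ℝ} (hr : Tendsto r atTop atTop) {S : ℕ → Inp ⊕ Chan → TCTSeq}
    (hS : ∀ k, N.IsSignals u ε (S k)) (h : ∀ k Γ, AgreeUpTo (r k) (S k Γ) (W Γ)) :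
    N.IsSignals u ε W where
  inl i := AgreeUpTo.eq_of_forall fun T => by
    obtain ⟨k, hk⟩ := (hr.eventually_ge_atTop T).exists
    have hkT := (h k (.inl i)).mono hk
    rw [(hS k).inl] at hkT
    exact hkT.symm
  tct Γ := isTCT_of_limit hr (fun k => (hS k).tct Γ) fun k => h k Γ
  init Γ := (h 0 Γ 0 _ bot_le).1 ((hS 0).init Γ)
  nonneg Γ n a ha := by
    obtain ⟨k, hk⟩ := (eventually_get?_eq hr (fun k => h k Γ) ha).exists
    exact (hS k).nonneg Γ n a hk
  causal p := .of_limit hr (fun k => (hS k).causal p) fun k => (h k (N.src p)).shifter _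

end IsSignals

/-- The time up to which signals agree after `k` applications of the channel functions. Before any
application they agree up to time `-1`, as all but the initial transitions are at times `≥ 0`. -/
def horizon (ε : ℝ) (k : ℕ) : ℝ := -1 + k * ε

theorem horizon_zero (ε : ℝ) : horizon ε 0 = -1 := by
  rw [horizon, Nat.cast_zero, zero_mul, add_zero]

theorem horizon_succ (ε : ℝ) (k : ℕ) : horizon ε (k + 1) = horizon ε k + ε := by
  rw [horizon, horizon, Nat.cast_succ, add_one_mul, add_assoc]

theorem monotone_horizon (hε : 0 ≤ ε) : Monotone (horizon ε) :=
  monotone_nat_of_le_succ fun k => by linarith [horizon_succ ε k]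

theorem tendsto_horizon (hε : 0 < ε) : Tendsto (horizon ε) atTop atTop :=
  tendsto_atTop_add_const_left _ _ (tendsto_natCast_atTop_atTop.atTop_mul_const hε)

theorem eq_of_forall_agreeUpTo {r : ℕ → ℝ} (hr : Tendsto r atTop atTop)
    (h : ∀ k Γ, AgreeUpTo (r k) (W₁ Γ) (W₂ Γ)) : W₁ = W₂ := by
  funext Γ
  refine AgreeUpTo.eq_of_forall fun T => ?_
  obtain ⟨k, hk⟩ := (hr.eventually_ge_atTop T).exists
  exact (h k Γ).mono hk

namespace IsSignals

theorem agreeUpTo_horizon {S S' : ℕ → Inp ⊕ Chan → TCTSeq} (hS : ∀ k, N.IsSignals u ε (S k))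
    (hS' : ∀ k, N.IsSignals u ε (S' k)) (hε : 0 ≤ ε) (hm : ∀ k, N.MapsTo (S k) (S (k + 1)))
    (hm' : ∀ k, N.MapsTo (S' k) (S' (k + 1))) (k : ℕ) :
    ∀ Γ, AgreeUpTo (horizon ε k) (S k Γ) (S' k Γ) := by
  induction k with
  | zero => exact horizon_zero ε ▸ (hS 0).agreeUpTo_neg_one (hS' 0)
  | succ k ih =>
    exact horizon_succ ε k ▸ (hS k).agreeUpTo_add (hS' k) hε (hS (k + 1)) (hS' (k + 1)) (hm k)
      (hm' k) ih

theorem eq_of_mapsTo_self (h₁ : N.IsSignals u ε W₁) (h₂ : N.IsSignals u ε W₂) (hε : 0 < ε)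
    (hm₁ : N.MapsTo W₁ W₁) (hm₂ : N.MapsTo W₂ W₂) : W₁ = W₂ :=
  eq_of_forall_agreeUpTo (tendsto_horizon hε) <| agreeUpTo_horizon (fun _ => h₁) (fun _ => h₂)
    hε.le (fun _ => hm₁) fun _ => hm₂

theorem mapsTo_self_of_limit {S : ℕ → Inp ⊕ Chan → TCTSeq} (hS : ∀ k, N.IsSignals u ε (S k))
    (hm : ∀ k, N.MapsTo (S k) (S (k + 1))) (hu : N.AdmissibleInput u) (hε0 : 0 < ε)
    (hε : N.HasMargin ε) (hW : N.IsSignals u ε W)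
    (h : ∀ k Γ, AgreeUpTo (horizon ε k) (S k Γ) (W Γ)) : N.MapsTo W W := by
  obtain ⟨W', hW', hmW⟩ := hW.exists_mapsTo hu hε0.le hε
  have hWW' : W' = W := eq_of_forall_agreeUpTo (r := fun k => horizon ε (k + 1))
    ((tendsto_horizon hε0).comp (tendsto_add_atTop_nat 1)) fun k Γ =>
      .trans (horizon_succ ε k ▸ hW.agreeUpTo_add (hS k) hε0.le hW' (hS (k + 1)) hmW (hm k)
        (fun Γ => (h k Γ).symm) Γ) (h (k + 1) Γ)
  exact hWW' ▸ hmW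

end IsSignals

theorem exists_isSignals_mapsTo_self (hu : N.AdmissibleInput u) (hε0 : 0 < ε)
    (hε : N.HasMargin ε) : ∃ W : Inp ⊕ Chan → TCTSeq, N.IsSignals u ε W ∧ N.MapsTo W W := by
  obtain ⟨W₀, hW₀⟩ := exists_isSignals hu hε
  choose Φ hΦ hΦm using
    fun W : {W : Inp ⊕ Chan → TCTSeq // N.IsSignals u ε W} => W.2.exists_mapsTo hu hε0.le hε
  let S : ℕ → {W : Inp ⊕ Chan → TCTSeq // N.IsSignals u ε W} :=
    fun k => Nat.rec ⟨W₀, hW₀⟩ (fun _ W => ⟨Φ W, hΦ W⟩) k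
  have hm : ∀ k, N.MapsTo (S k).1 (S (k + 1)).1 := fun k => hΦm (S k)
  have hS := IsSignals.agreeUpTo_horizon (fun k => (S k).2) (fun k => (S (k + 1)).2) hε0.le hm
    fun k => hm (k + 1)
  choose W hW using fun Γ => exists_limit (monotone_horizon hε0.le) (fun k => hS k Γ)
    fun k => ((S k).2.tct Γ).wst
  have hWs : N.IsSignals u ε W :=
    .of_limit (tendsto_horizon hε0) (fun k => (S k).2) fun k Γ => hW Γ k
  exact ⟨W, hWs,
    IsSignals.mapsTo_self_of_limit (fun k => (S k).2) hm hu hε0 hε hWs fun k Γ => hW Γ k⟩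

end Circuit

/-! ### Simulator signals -/

namespace Driver

/-- The next scheduled transition of the simulator signal `D` is scheduled for time `t`. -/
def IsDue (D : Driver) (t : ℝ) : Prop :=
  D.pend.head?.map Prod.fst = some t

/-- The scheduled transitions of `D` are in the order of their times, and none is before time
`t`. -/
structure IsSchedule (D : Driver) (t : ℝ) : Prop where
  sorted : D.pend.Pairwise fun e e' => e.1 < e'.1
  le : ∀ e ∈ D.pend, t ≤ e.1

variable {D : Driver} {t t' : ℝ}

theorem isDue_iff : D.IsDue t ↔ ∃ x l, D.pend = (t, x) :: l := by
  obtain ⟨c, _ | ⟨⟨s, x⟩, l⟩⟩ := D <;> simp [IsDue]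

theorem pend_advance (D : Driver) : D.advance.pend = D.pend.tail := by
  obtain ⟨c, _ | ⟨e, l⟩⟩ := D <;> rfl

theorem IsDue.length_advance_lt (h : D.IsDue t) : D.advance.pend.length < D.pend.length := by
  obtain ⟨x, l, hD⟩ := isDue_iff.1 h
  rw [pend_advance, hD, List.tail_cons, List.length_cons]
  exact Nat.lt_succ_self _

theorem value_eq_cur (h : ∀ e ∈ D.pend, t < e.1) : D.value t = D.cur := by
  have hnil : D.pend.filter (fun e => e.1 ≤ t) = [] :=
    List.filter_eq_nil_iff.2 fun e he => by simpa only [decide_eq_true_eq, not_le] using h e he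
  simp only [value, hnil, List.getLast?_nil, Option.map_none, Option.getD_none]

theorem value_sched_of_le (D : Driver) (x : Bool) (h : t ≤ t') : (D.sched t x).value t' = x := by
  simp [value, sched, List.filter_append, h]

theorem value_sched_of_lt (D : Driver) (x : Bool) (h : t' < t) :
    (D.sched t x).value t' = D.value t' := by
  have hfilter : ∀ e : ℝ × Bool, (decide (e.1 ≤ t') && decide (e.1 < t)) = decide (e.1 ≤ t') := by
    intro e
    by_cases he : e.1 ≤ t'
    · simp [he, he.trans_lt h]
    · simp [he]
  simp [value, sched, List.filter_append, not_le.2 h, hfilter]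

theorem IsDue.value_advance (h : D.IsDue t) (ht : t ≤ t') : D.advance.value t' = D.value t' := by
  obtain ⟨c, p⟩ := D
  obtain ⟨x, l, rfl : p = _⟩ := isDue_iff.1 h
  simp only [value, advance, ht, decide_true, List.filter_cons_of_pos, List.getLast?_cons]
  cases (l.filter fun e => e.1 ≤ t').getLast? <;> rfl

theorem IsSchedule.lt_of_mem (h : D.IsSchedule t) (hD : ∀ s, D.IsDue s → t' < s) :
    ∀ e ∈ D.pend, t' < e.1 := by
  have hsorted := h.sorted
  cases hpend : D.pend with
  | nil => exact fun e he => nomatch he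
  | cons b l =>
    have hb : t' < b.1 := hD b.1 (isDue_iff.2 ⟨b.2, l, hpend⟩)
    rw [hpend, List.pairwise_cons] at hsorted
    exact List.forall_mem_cons.2 ⟨hb, fun e he => hb.trans (hsorted.1 e he)⟩

theorem IsSchedule.of_isDue (h : D.IsSchedule t) (hD : ∀ s, D.IsDue s → t' ≤ s) :
    D.IsSchedule t' :=
  ⟨h.sorted, fun e he => le_of_forall_lt fun _ hr =>
    h.lt_of_mem (fun s hs => hr.trans_le (hD s hs)) e he⟩

theorem IsSchedule.advance (h : D.IsSchedule t) : D.advance.IsSchedule t := by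
  have hsub : D.advance.pend.Sublist D.pend := pend_advance D ▸ List.tail_sublist _
  exact ⟨h.sorted.sublist hsub, fun e he => h.le e (hsub.subset he)⟩

theorem IsSchedule.sched (h : D.IsSchedule t) (ht : t ≤ t') (x : Bool) :
    (D.sched t' x).IsSchedule t := by
  constructor
  · refine List.pairwise_append.2 ⟨h.sorted.filter _, List.pairwise_singleton _ _, ?_⟩
    intro e he e' he'
    rw [List.mem_singleton.1 he']
    exact of_decide_eq_true (List.mem_filter.1 he).2
  · intro e he
    rcases List.mem_append.1 he with he | he
    · exact h.le e (List.mem_filter.1 he).1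
    · exact List.mem_singleton.1 he ▸ ht

theorem cur_update {ι : Type*} [DecidableEq ι] {f : ι → Driver} {i : ι} (h : D.cur = (f i).cur)
    (j : ι) : (Function.update f i D j).cur = (f j).cur := by
  rcases eq_or_ne j i with rfl | hj
  · rwa [Function.update_self]
  · rw [Function.update_of_ne hj]

open Classical in
/-- The effect of `procGI` on the signal `evGO`: the value `x` is scheduled for time `t` unless `D`
has that value anyway. -/
def ensure (D : Driver) (t : ℝ) (x : Bool) : Driver :=
  if D.value t ≠ x then D.sched t x else D

theorem cur_ensure (D : Driver) (t : ℝ) (x : Bool) : (D.ensure t x).cur = D.cur := by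
  unfold ensure
  split_ifs <;> rfl

theorem value_ensure (D : Driver) (t : ℝ) (x : Bool) : (D.ensure t x).value t = x := by
  unfold ensure
  split_ifs with h
  · exact value_sched_of_le D x le_rfl
  · exact not_ne_iff.1 h

theorem pend_ensure (hD : D.pend = [] ∨ ∃ y, D.pend = [(t, y)]) (x : Bool) :
    (D.ensure t x).pend = [] ∨ ∃ y, (D.ensure t x).pend = [(t, y)] := by
  by_cases h : D.value t = x
  · simpa only [ensure, if_neg (not_ne_iff.2 h)] using hD
  · rw [ensure, if_pos h]
    refine .inr ⟨x, ?_⟩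
    rcases hD with hD | ⟨y, hD⟩ <;> simp [sched, hD]

end Driver

/-! ### Records of signals -/

/-- The list `l` contains only transitions of `s` up to time `t`, in order, and all those before
time `t`. -/
structure IsRecord (s : TCTSeq) (t : ℝ) (l : List Transition) : Prop where
  length_pos : 0 < l.length
  get? : ∀ n a, l[n]? = some a → s.get? n = some a ∧ a.t ≤ t
  le_t : ∀ a, s.get? l.length = some a → t ≤ a.t

namespace IsRecord

variable {s : TCTSeq} {t t' : ℝ} {l : List Transition} {a : Transition}

theorem getLast (h : IsRecord s t l) (ha : l.getLast? = some a) :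
    s.get? (l.length - 1) = some a ∧ a.t ≤ t :=
  h.get? _ a (List.getLast?_eq_getElem? ▸ ha)

theorem mono (h : IsRecord s t l) (ht : t ≤ t') (hle : ∀ a, s.get? l.length = some a → t' ≤ a.t) :
    IsRecord s t' l :=
  ⟨h.length_pos, fun n a ha => (h.get? n a ha).imp_right fun hat =>
    hat.trans (WithBot.coe_le_coe.2 ht), hle⟩

theorem append (h : IsRecord s t l) (hs : IsWST (TCTSeq.scheduled s))
    (ha : s.get? l.length = some a) (hat : a.t = t) : IsRecord s t (l ++ [a]) where
  length_pos := by simp only [List.length_append, List.length_singleton, Nat.succ_pos]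
  get? n b hb := by
    rw [List.getElem?_append] at hb
    split_ifs at hb with hn
    · exact h.get? n b hb
    · obtain ⟨hn', rfl⟩ := List.getElem?_eq_some_iff.1 hb
      rw [List.length_singleton] at hn'
      obtain rfl : n = l.length := by omega
      simpa using ⟨ha, hat.le⟩
  le_t b hb := by
    rw [List.length_append, List.length_singleton] at hb
    exact hat ▸ (hs.t_lt_t l.length.lt_succ_self ha hb).le

theorem t_getLast_lt (h : IsRecord s t l) (hs : IsWST (TCTSeq.scheduled s)) {b : Transition}
    (hb : l.getLast? = some b) (ha : s.get? l.length = some a) : b.t < a.t :=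
  hs.t_lt_t (Nat.sub_one_lt h.length_pos.ne') (h.getLast hb).1 ha

theorem x_eq_not (h : IsRecord s t l) (hs : IsWST (TCTSeq.scheduled s)) {x : Bool}
    (hx : l.getLast?.map Transition.x = some x) (ha : s.get? l.length = some a) : a.x = !x := by
  obtain ⟨b, hb, rfl⟩ := Option.map_eq_some_iff.1 hx
  exact hs.x_eq_not (h.getLast hb).1 ((Nat.sub_add_cancel h.length_pos).symm ▸ ha)

theorem exists_next (h : IsRecord s t l) (hs : IsWST (TCTSeq.scheduled s)) {x v : Bool}
    (hx : l.getLast?.map Transition.x = some x) (hv : WSTState (TCTSeq.scheduled s) t v)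
    (hne : v ≠ x) : ∃ a, s.get? l.length = some a ∧ a.t = t ∧ a.x = v := by
  obtain ⟨b, hb, rfl⟩ := Option.map_eq_some_iff.1 hx
  obtain ⟨hbs, hbt⟩ := h.getLast hb
  obtain ⟨c, hc, hct⟩ := hs.exists_next (get?_scheduled_of hbs) hbt hv hne
  rw [Nat.sub_add_cancel h.length_pos] at hc
  obtain ⟨a, ha, rfl⟩ := exists_of_get?_scheduled hc
  exact ⟨a, ha, le_antisymm hct (h.le_t a ha),
    (h.x_eq_not hs hx ha).trans (Bool.eq_not.2 hne).symm⟩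

end IsRecord

/-! ### Local invariants -/

/-- The invariant of the signals `ti = evTI(Γ, I, C)` and `gi = evGI(I, C)` at time `t`, where `l`
is the file of `Γ` and `s` is the signal behind the shifter at the input `I` of `C`. The transitions
scheduled for `gi` account for all entries of `l` except for one still signalled by `ti`. -/
structure PinInv (s : TCTSeq) (t : ℝ) (l : List Transition) (ti gi : Driver) : Prop where
  ti_pend : ti.pend = [] ∨ ti.pend = [(t, !ti.cur)] ∧ ∃ a, l.getLast? = some a ∧ a.t = t
  schedule : gi.IsSchedule t
  state : ∀ t', t ≤ t' → PartState s (l.length - ti.pend.length) t' (gi.value t')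

/-- The invariant of the signal `go = evGO(C)` at time `t`, where `l` is the file of `C`, `w` is the
output of its gate, and `y` is the value of the gate for the current values of `evGI`. -/
structure GateInv (w : WSTSeq) (y : Bool) (t : ℝ) (l : List Transition) (go : Driver) : Prop where
  pend : go.pend = [] ∨ ∃ x, go.pend = [(t, x)]
  cur : l.getLast?.map Transition.x = some go.cur
  value : go.value t = y ∨ WSTState w t (go.value t)

theorem PartState.succ_self {s : TCTSeq} {k : ℕ} {t : ℝ} {b : Transition}
    (hb : s.get? k = some b) (hbt : b.t ≤ t) (hbo : b.occ ≤ t) : PartState s (k + 1) t b.x :=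
  ⟨k, b, k.lt_succ_self, hb, rfl, hbt, hbo, fun _ hm hmk =>
    absurd hm (Nat.lt_succ_iff.1 hmk).not_gt⟩

theorem PartState.succ_of_not {s : TCTSeq} {k : ℕ} {t : ℝ} {v : Bool} (h : PartState s k t v)
    (hk : ∀ b, s.get? k = some b → b.t ≤ t → ¬ b.occ ≤ t) : PartState s (k + 1) t v := by
  obtain ⟨n, a, hnk, ha, hv, hat, hao, hmax⟩ := h
  refine ⟨n, a, hnk.trans k.lt_succ_self, ha, hv, hat, hao, fun m hm hmk b hb => ?_⟩
  rcases (Nat.lt_succ_iff.1 hmk).eq_or_lt with rfl | hlt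
  · exact hk b hb
  · exact hmax m hm hlt b hb

namespace PinInv

variable {s : TCTSeq} {t t' : ℝ} {l : List Transition} {ti gi : Driver}

theorem ti_pend_eq_nil (h : PinInv s t l ti gi) (hti : ¬ ti.IsDue t) : ti.pend = [] :=
  h.ti_pend.resolve_right fun hp => hti (Driver.isDue_iff.2 ⟨_, _, hp.1⟩)

theorem partState (h : PinInv s t l ti gi) (hti : ti.pend = []) (ht : t ≤ t') :
    PartState s l.length t' (gi.value t') := by
  simpa only [hti, List.length_nil, Nat.sub_zero] using h.state t' ht

theorem mono (h : PinInv s t l ti gi) (ht : t ≤ t') (hti : ti.pend = [])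
    (hgi : ∀ r, gi.IsDue r → t' ≤ r) : PinInv s t' l ti gi :=
  ⟨.inl hti, h.schedule.of_isDue hgi, fun r hr => h.state r (ht.trans hr)⟩

theorem emit (h : PinInv s t l ti gi) (hti : ti.pend = []) {a : Transition} (hat : a.t = t) :
    PinInv s t (l ++ [a]) (ti.toggle t) gi := by
  have hpend : (ti.toggle t).pend = [(t, !ti.cur)] := by
    simp only [Driver.toggle, Driver.sched, hti, List.filter_nil, List.nil_append,
      List.getLast?_nil, Option.map_none, Option.getD_none]
  refine ⟨.inr ⟨hpend, a, List.getLast?_concat, hat⟩, h.schedule, fun t' ht' => ?_⟩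
  rw [hpend, List.length_append, List.length_singleton, List.length_singleton,
    Nat.add_sub_cancel]
  exact h.partState hti ht'

theorem cur_advance_ne (h : PinInv s t l ti gi) (hti : ti.IsDue t) : ti.advance.cur ≠ ti.cur := by
  obtain ⟨x, m, hxm⟩ := Driver.isDue_iff.1 hti
  have hpend := (h.ti_pend.resolve_left (hxm ▸ List.cons_ne_nil _ _)).1
  simp only [Driver.advance, hpend, ne_eq, Bool.not_eq_self, not_false_eq_true]

theorem procTI (h : PinInv s t l ti gi) (hti : ti.IsDue t) {b : Transition} (hl : 0 < l.length)
    (hb : s.get? (l.length - 1) = some b) {q : ℝ} (htq : t ≤ q)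
    (hq : ∀ r : ℝ, q ≤ r ↔ b.t ≤ r ∧ b.occ ≤ r) : PinInv s t l ti.advance (gi.sched q b.x) := by
  obtain ⟨x, m, hxm⟩ := Driver.isDue_iff.1 hti
  have hpend := (h.ti_pend.resolve_left (hxm ▸ List.cons_ne_nil _ _)).1
  have hadv : ti.advance.pend = [] := by rw [Driver.pend_advance, hpend, List.tail_cons]
  refine ⟨.inl hadv, h.schedule.sched htq _, fun t' ht' => ?_⟩
  have hps := h.state t' ht'
  rw [hpend, List.length_singleton] at hps
  rw [hadv, List.length_nil, Nat.sub_zero, ← Nat.sub_add_cancel hl]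
  by_cases hqt : q ≤ t'
  · rw [Driver.value_sched_of_le _ _ hqt]
    exact .succ_self hb ((hq t').1 hqt).1 ((hq t').1 hqt).2
  · rw [Driver.value_sched_of_lt _ _ (not_le.1 hqt)]
    refine hps.succ_of_not fun c hc hct hco => hqt ((hq t').2 ?_)
    obtain rfl := Option.some.inj (hb.symm.trans hc)
    exact ⟨hct, hco⟩

theorem advance_gi (h : PinInv s t l ti gi) (hgi : gi.IsDue t) : PinInv s t l ti gi.advance :=
  ⟨h.ti_pend, h.schedule.advance, fun t' ht' => hgi.value_advance ht' ▸ h.state t' ht'⟩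

end PinInv

namespace GateInv

variable {w : WSTSeq} {y : Bool} {t : ℝ} {l : List Transition} {go : Driver}

theorem pend_eq_nil (h : GateInv w y t l go) (hgo : ¬ go.IsDue t) : go.pend = [] :=
  h.pend.resolve_right fun ⟨_, hp⟩ => hgo (Driver.isDue_iff.2 ⟨_, _, hp⟩)

theorem cur_eq (h : GateInv w y t l go) (hgo : go.pend = []) (hy : WSTState w t y) :
    go.cur = y := by
  have hval : go.value t = go.cur := Driver.value_eq_cur fun e he => by
    rw [hgo] at he
    exact nomatch he
  exact hval ▸ h.value.elim id fun hs => hs.unique hy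

theorem ensure (h : GateInv w y t l go) {x : Bool} (hx : WSTState w t x) (y' : Bool) :
    GateInv w y' t l (go.ensure t x) :=
  ⟨Driver.pend_ensure h.pend x, (Driver.cur_ensure go t x).symm ▸ h.cur,
    .inr ((Driver.value_ensure go t x).symm ▸ hx)⟩

theorem advance (h : GateInv w y t l go) (hgo : go.IsDue t) (hs : WSTState w t (go.value t))
    {l' : List Transition} (hl' : l'.getLast?.map Transition.x = some go.advance.cur) :
    GateInv w y t l' go.advance := by
  refine ⟨.inl ?_, hl', .inr (hgo.value_advance le_rfl ▸ hs)⟩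
  obtain ⟨x, m, hxm⟩ := Driver.isDue_iff.1 hgo
  obtain ⟨x, hp⟩ := h.pend.resolve_left (hxm ▸ List.cons_ne_nil _ _)
  rw [Driver.pend_advance, hp, List.tail_cons]

theorem cur_advance (h : GateInv w y t l go) (hgo : go.IsDue t) :
    go.advance.cur = go.value t := by
  obtain ⟨x, m, hxm⟩ := Driver.isDue_iff.1 hgo
  obtain ⟨x, hp⟩ := h.pend.resolve_left (hxm ▸ List.cons_ne_nil _ _)
  simp [Driver.advance, Driver.value, hp]

end GateInv

/-! ### The invariant of the simulation -/

namespace Circuit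

variable {Inp Out Chan : Type*} {N : Circuit Inp Out Chan} {u : Inp → TCTSeq} {ε : ℝ}
  {W : Inp ⊕ Chan → TCTSeq} {st : N.SimState} {t t' : ℝ}

theorem MapsTo.wstState (hm : N.MapsTo W W) (ht : 0 ≤ t) {C : Chan}
    {v : Fin (N.channel C).d → Bool} (hv : ∀ I, TCTState (N.pinSignal W ⟨C, I⟩) t (v I)) :
    WSTState (TCTSeq.scheduled (W (.inr C))) t ((N.channel C).f v) := by
  obtain ⟨ug, hg, hd⟩ := hm C
  obtain ⟨v', hv', hs⟩ := hg.state t ht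
  obtain rfl : v = v' := funext fun I => (hv I).unique (hv' I)
  exact hd.scheduled ▸ hs

theorem IsSignals.exists_t_eq (hW : N.IsSignals u ε W) {Γ : Inp ⊕ Chan} {n : ℕ} {a : Transition}
    (ha : (W Γ).get? n = some a) (hn : 0 < n) : ∃ r : ℝ, a.t = r :=
  have hlt : (⊥ : WithBot ℝ) < a.t := (hW.tct Γ).wst.t_lt_t hn (hW.init Γ) ha
  (WithBot.ne_bot_iff_exists.1 hlt.ne').imp fun _ => Eq.symm

variable (N) in
/-- No event of rank less than `k` is due up to time `t`. -/
def IsIdle (u : Inp → TCTSeq) (st : N.SimState) (k : ℕ) (t : ℝ) : Prop :=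
  ∀ ev s, N.Due u st ev s → ev.rank < k → t < s

theorem IsIdle.mono {k k' : ℕ} (h : N.IsIdle u st k t) (hk : k' ≤ k) (ht : t' ≤ t) :
    N.IsIdle u st k' t' :=
  fun ev s hd hr => ht.trans_lt (h ev s hd (hr.trans_le hk))

/-- The invariant of the simulation at time `t`, relative to the signals `W` of the execution. -/
structure SimInv (W : Inp ⊕ Chan → TCTSeq) (st : N.SimState) (t : ℝ) : Prop where
  nonneg : 0 ≤ t
  file : ∀ Γ, IsRecord (W Γ) t (st.F Γ)
  pin : ∀ p, PinInv (N.pinSignal W p) t (st.F (N.src p)) (st.ti p) (st.gi p)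
  gate : ∀ C, GateInv (TCTSeq.scheduled (W (.inr C)))
    ((N.channel C).f fun I => (st.gi ⟨C, I⟩).cur) t (st.F (.inr C)) (st.go C)

namespace SimInv

theorem le_of_due (hW : N.IsSignals u ε W) (h : SimInv W st t) {ev : N.Event} {s : ℝ}
    (hd : N.Due u st ev s) : t ≤ s := by
  cases ev with
  | ext i =>
    obtain ⟨a, ha, has⟩ := hd
    exact WithBot.coe_le_coe.1 (has ▸ (h.file (.inl i)).le_t a (hW.inl i ▸ ha))
  | ti p =>
    obtain ⟨x, l, hl⟩ := Driver.isDue_iff.1 hd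
    rcases (h.pin p).ti_pend with hp | ⟨hp, -⟩ <;> cases hl.symm.trans hp
    exact le_rfl
  | gi p =>
    obtain ⟨x, l, hl⟩ := Driver.isDue_iff.1 hd
    exact (h.pin p).schedule.le (s, x) (hl ▸ List.mem_cons_self)
  | go C =>
    obtain ⟨x, l, hl⟩ := Driver.isDue_iff.1 hd
    rcases (h.gate C).pend with hp | ⟨y, hp⟩ <;> cases hl.symm.trans hp
    exact le_rfl

theorem lt_t_inl (hW : N.IsSignals u ε W) (h : SimInv W st t) {k : ℕ}
    (hidle : N.IsIdle u st (k + 1) t') {i : Inp} {a : Transition}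
    (ha : (W (.inl i)).get? (st.F (.inl i)).length = some a) : t' < a.t := by
  obtain ⟨r, hr⟩ := hW.exists_t_eq ha (h.file _).length_pos
  exact hr ▸ WithBot.coe_lt_coe.2 (hidle (.ext i) r ⟨a, hW.inl i ▸ ha, hr⟩ k.succ_pos)

theorem lt_t_add_pinLag (hW : N.IsSignals u ε W) (hε : 0 < ε) (h : SimInv W st t)
    (hidle : N.IsIdle u st 2 t')
    (hchan : ∀ C a, (W (.inr C)).get? (st.F (.inr C)).length = some a → t' ≤ a.t) {p : N.Pin}
    {a : Transition} (ha : (W (N.src p)).get? (st.F (N.src p)).length = some a) :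
    t' < a.t + (N.pinLag ε p : WithBot ℝ) := by
  unfold pinLag
  cases hsrc : N.src p with
  | inl i =>
    rw [Sum.elim_inl, WithBot.coe_zero, add_zero]
    exact h.lt_t_inl hW hidle (hsrc ▸ ha)
  | inr C =>
    obtain ⟨r, hr⟩ := hW.exists_t_eq ha (h.file _).length_pos
    have htr := hchan C a (hsrc ▸ ha)
    rw [hr] at htr ⊢
    rw [Sum.elim_inr]
    norm_cast at htr ⊢
    linarith

theorem tctState (hW : N.IsSignals u ε W) (hε : 0 < ε) (h : SimInv W st t) (ht : t ≤ t')
    (hidle : N.IsIdle u st 2 t')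
    (hchan : ∀ C a, (W (.inr C)).get? (st.F (.inr C)).length = some a → t' ≤ a.t) (p : N.Pin) :
    TCTState (N.pinSignal W p) t' ((st.gi p).value t') := by
  have hti : (st.ti p).pend = [] := (h.pin p).ti_pend_eq_nil fun hd =>
    (hidle (.ti p) t hd Nat.one_lt_two).not_ge ht
  refine ((h.pin p).partState hti ht).tctState (hW.isOrdered p) (N.pinLag_nonneg hε.le p)
    (hW.causal p) fun m hm b hb => ?_
  obtain ⟨a, ha, hbt, -⟩ := exists_of_get?_shifter hb
  obtain ⟨c, hc⟩ := (W (N.src p)).ge_stable hm ha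
  calc (t' : WithBot ℝ) < c.t + (N.pinLag ε p : WithBot ℝ) :=
        h.lt_t_add_pinLag hW hε hidle hchan hc
    _ ≤ b.t + (N.pinLag ε p : WithBot ℝ) := by
        rw [hbt]
        gcongr
        exact (hW.tct _).wst.le_of_le hm (get?_scheduled_of hc) (get?_scheduled_of ha)

theorem gateState (hW : N.IsSignals u ε W) (hm : N.MapsTo W W) (hε : 0 < ε) (h : SimInv W st t)
    (ht : t ≤ t') (hidle : N.IsIdle u st 2 t')
    (hchan : ∀ C a, (W (.inr C)).get? (st.F (.inr C)).length = some a → t' ≤ a.t) (C : Chan) :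
    WSTState (TCTSeq.scheduled (W (.inr C))) t'
      ((N.channel C).f fun I => (st.gi ⟨C, I⟩).value t') :=
  hm.wstState (h.nonneg.trans ht) fun _ => h.tctState hW hε ht hidle hchan _

theorem gateState_cur (hW : N.IsSignals u ε W) (hm : N.MapsTo W W) (hε : 0 < ε)
    (h : SimInv W st t) (ht : t ≤ t') (hidle : N.IsIdle u st 3 t')
    (hchan : ∀ C a, (W (.inr C)).get? (st.F (.inr C)).length = some a → t' ≤ a.t) (C : Chan) :
    WSTState (TCTSeq.scheduled (W (.inr C))) t'
      ((N.channel C).f fun I => (st.gi ⟨C, I⟩).cur) := by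
  have hcur : ∀ p, (st.gi p).value t' = (st.gi p).cur := fun p =>
    Driver.value_eq_cur <| (h.pin p).schedule.lt_of_mem fun s hs =>
      hidle (.gi p) s hs (Nat.lt_succ_self 2)
  simpa only [hcur] using
    h.gateState hW hm hε ht (hidle.mono (Nat.le_succ 2) le_rfl) hchan C

theorem cur_go_eq (hW : N.IsSignals u ε W) (hm : N.MapsTo W W) (hε : 0 < ε) (h : SimInv W st t)
    (hidle : N.IsIdle u st 4 t) (C : Chan) :
    (st.go C).pend = [] ∧ (st.go C).cur = (N.channel C).f fun I => (st.gi ⟨C, I⟩).cur := by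
  have hgo : (st.go C).pend = [] := (h.gate C).pend_eq_nil fun hd =>
    (hidle (.go C) t hd (Nat.lt_succ_self 3)).false
  exact ⟨hgo, (h.gate C).cur_eq hgo <|
    h.gateState_cur hW hm hε le_rfl (hidle.mono (Nat.le_succ 3) le_rfl)
      (fun C => (h.file (.inr C)).le_t) C⟩

/-- Until the earliest missing transition of a channel, all its inputs have the states of the
execution; so this transition would contradict the value of `evGO`. -/
theorem lt_t_of_forall_le (hW : N.IsSignals u ε W) (hm : N.MapsTo W W) (hε : 0 < ε)
    (h : SimInv W st t) (ht : t ≤ t') (hidle : N.IsIdle u st 4 t') {C : Chan} {a : Transition}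
    (ha : (W (.inr C)).get? (st.F (.inr C)).length = some a)
    (hmin : ∀ D b, (W (.inr D)).get? (st.F (.inr D)).length = some b → a.t ≤ b.t) :
    t' < a.t := by
  by_contra! hat
  have hwst := (hW.tct (.inr C)).wst
  obtain ⟨r, hr⟩ := hW.exists_t_eq ha (h.file _).length_pos
  have htr : t ≤ r := WithBot.coe_le_coe.1 (hr ▸ (h.file _).le_t a ha)
  have hrt : r ≤ t' := WithBot.coe_le_coe.1 (hr ▸ hat)
  have hcur := (h.cur_go_eq hW hm hε (hidle.mono le_rfl ht) C).2
  have hstate := h.gateState_cur hW hm hε htr (hidle.mono (Nat.le_succ 3) hrt)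
    (fun D b hb => hr ▸ hmin D b hb) C
  have hax : a.x = (st.go C).cur :=
    hcur ▸ (hwst.state_at (get?_scheduled_of ha) hr).unique hstate
  exact Bool.not_ne_self _ (hax ▸ ((h.file _).x_eq_not hwst (h.gate C).cur ha)).symm

theorem lt_t [Finite Chan] (hW : N.IsSignals u ε W) (hm : N.MapsTo W W) (hε : 0 < ε)
    (h : SimInv W st t) (ht : t ≤ t') (hidle : N.IsIdle u st 4 t') (Γ : Inp ⊕ Chan)
    (a : Transition) (ha : (W Γ).get? (st.F Γ).length = some a) : t' < a.t := by
  cases Γ with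
  | inl i => exact h.lt_t_inl hW hidle ha
  | inr C =>
    let next (C : Chan) : Option Transition := (W (.inr C)).get? (st.F (.inr C)).length
    obtain ⟨D, ⟨b, hb⟩, hmin⟩ := Set.exists_min_image {C | ∃ a, next C = some a}
      (fun C => ((next C).map Transition.t).getD ⊥) (Set.toFinite _) ⟨C, a, ha⟩
    have hle : ∀ E c, next E = some c → b.t ≤ c.t := fun E c hc => by
      simpa only [hb, hc, Option.map_some, Option.getD_some] using hmin E ⟨c, hc⟩
    exact (h.lt_t_of_forall_le hW hm hε ht hidle hb hle).trans_le (hle C a ha)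

theorem advance_time [Finite Chan] (hW : N.IsSignals u ε W) (hm : N.MapsTo W W) (hε : 0 < ε)
    (h : SimInv W st t) (ht : t < t') (hdue : ∀ ev s, N.Due u st ev s → t' ≤ s) :
    SimInv W st t' where
  nonneg := h.nonneg.trans ht.le
  file Γ := (h.file Γ).mono ht.le fun a ha => by
    obtain ⟨r, hr⟩ := hW.exists_t_eq ha (h.file _).length_pos
    refine hr ▸ WithBot.coe_le_coe.2 (le_of_forall_lt fun s hs => ?_)
    have hlt := h.lt_t hW hm hε (le_max_left t s)
      (fun ev q hd _ => (max_lt ht hs).trans_le (hdue ev q hd)) Γ a ha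
    exact (le_max_right t s).trans_lt (WithBot.coe_lt_coe.1 (hr ▸ hlt))
  pin p := (h.pin p).mono ht.le
    ((h.pin p).ti_pend_eq_nil fun hd => ht.not_ge (hdue (.ti p) t hd)) (hdue (.gi p))
  gate C := by
    obtain ⟨hgo, hcur⟩ := h.cur_go_eq hW hm hε
      (fun ev s hd _ => ht.trans_le (hdue ev s hd)) C
    refine ⟨.inl hgo, (h.gate C).cur, .inl ?_⟩
    rw [← hcur]
    exact Driver.value_eq_cur fun e he => by simp [hgo] at he

end SimInv

end Circuit

/-! ### Handling of events -/

theorem Channel.delay_sub_Δchar (C : Channel) (x : Bool) (T : WithTop ℝ) :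
    C.delay x (T + ((-C.Δchar x : ℝ) : WithTop ℝ)) - C.Δchar x = C.inv.delay x T := by
  rw [Channel.delay, add_assoc, ← WithTop.coe_add, neg_add_cancel, WithTop.coe_zero, add_zero,
    add_sub_cancel_left]

namespace Circuit

variable {Inp Out Chan : Type*} {N : Circuit Inp Out Chan} {u : Inp → TCTSeq} {ε : ℝ}
  {W : Inp ⊕ Chan → TCTSeq} {st : N.SimState} {t : ℝ}

theorem Supported.calcDelta_eq (hN : N.Supported) (p : N.Pin) (x : Bool) :
    calcDelta (N.channel p.1) x ((N.channel p.1).Δ p.2 true) ((N.channel p.1).Δ p.2 false) =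
      N.pinShift p x := by
  unfold calcDelta pinShift Channel.inShift
  by_cases hnot : (N.channel p.1).IsNot
  · cases x <;> simp [hnot]
  · by_cases hid : (N.channel p.1).IsId
    · cases x <;> simp [hnot, hid]
    · cases x <;> simp [hnot, hid, hN p.1 hnot hid p.2]

open Classical in
theorem exists_procTI_eq (hN : N.Supported) {p : N.Pin} {a : Transition}
    (ha : (st.F (N.src p)).getLast? = some a) (t : ℝ) :
    ∃ q, t ≤ q ∧ (∀ r : ℝ, q ≤ r ↔ t ≤ r ∧ a.occ + (N.pinShift p a.x : WithBot ℝ) ≤ r) ∧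
      st.procTI p t = { st with gi := Function.update st.gi p ((st.gi p).sched q a.x) } := by
  simp only [SimState.procTI, ha, hN.calcDelta_eq]
  cases a.occ with
  | bot => exact ⟨t, le_rfl, fun r => by simp, rfl⟩
  | coe s =>
    refine ⟨max t (s + N.pinShift p a.x), le_max_left _ _, fun r => ?_, rfl⟩
    rw [max_le_iff]
    norm_cast

open Classical in
theorem procGI_eq (st : N.SimState) (p : N.Pin) (t : ℝ) :
    st.procGI p t = { st with
      go := Function.update st.go p.1 ((st.go p.1).ensure t
        ((N.channel p.1).f fun I => (st.gi ⟨p.1, I⟩).value t)) } := by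
  simp only [SimState.procGI, Driver.ensure]
  split_ifs
  · rfl
  · rw [Function.update_eq_self]

theorem procGO_eq (hm : N.MapsTo W W) {C : Chan} (h : IsRecord (W (.inr C)) t (st.F (.inr C)))
    {c : Transition} (hc : (W (.inr C)).get? (st.F (.inr C)).length = some c) (hct : c.t = t) :
    st.procGO C t c.x = st.emit (.inr C) t c := by
  obtain ⟨ug, -, hdelay⟩ := hm C
  obtain ⟨a, ha⟩ : ∃ a, (st.F (.inr C)).getLast? = some a :=
    ⟨_, List.getLast?_eq_some_getLast (List.ne_nil_of_length_pos h.length_pos)⟩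
  have hco : c.o = _ := hdelay.offset _ a c t (h.getLast ha).1
    ((Nat.sub_add_cancel h.length_pos).symm ▸ hc) hct
  simp only [SimState.procGO, ha, Channel.delay_sub_Δchar]
  rw [← hct, ← hco]

namespace SimInv

theorem file_emit (hW : N.IsSignals u ε W) (h : SimInv W st t) {Γ : Inp ⊕ Chan} {a : Transition}
    (ha : (W Γ).get? (st.F Γ).length = some a) (hat : a.t = t) (Γ' : Inp ⊕ Chan) :
    IsRecord (W Γ') t ((st.emit Γ t a).F Γ') := by
  classical
  unfold SimState.emit
  rcases eq_or_ne Γ' Γ with rfl | hΓ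
  · simpa only [Function.update_self] using (h.file Γ').append (hW.tct Γ').wst ha hat
  · simpa only [Function.update_of_ne hΓ] using h.file Γ'

theorem pin_emit (hW : N.IsSignals u ε W) (h : SimInv W st t) {Γ : Inp ⊕ Chan} {a : Transition}
    (ha : (W Γ).get? (st.F Γ).length = some a) (hat : a.t = t) (p : N.Pin) :
    PinInv (N.pinSignal W p) t ((st.emit Γ t a).F (N.src p)) ((st.emit Γ t a).ti p) (st.gi p) := by
  classical
  unfold SimState.emit
  by_cases hp : N.src p = Γ
  · subst hp
    have hti : (st.ti p).pend = [] := by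
      refine (h.pin p).ti_pend.resolve_right fun ⟨_, b, hb, hbt⟩ => ?_
      exact ((h.file _).t_getLast_lt (hW.tct _).wst hb ha).ne (hbt.trans hat.symm)
    simpa only [Function.update_self, if_pos] using (h.pin p).emit hti hat
  · simpa only [Function.update_of_ne hp, if_neg hp] using h.pin p

theorem process_ext (hW : N.IsSignals u ε W) (h : SimInv W st t) {i : Inp}
    (hd : N.Due u st (.ext i) t) : SimInv W (N.process u st (.ext i) t) t := by
  obtain ⟨a, ha, hat⟩ := hd
  have hproc : N.process u st (.ext i) t = st.emit (.inl i) t a := by simp only [process, ha]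
  rw [← hW.inl] at ha
  rw [hproc]
  refine ⟨h.nonneg, h.file_emit hW ha hat, h.pin_emit hW ha hat, fun C => ?_⟩
  simpa only [SimState.emit, Function.update_of_ne Sum.inr_ne_inl] using h.gate C

theorem process_ti (hN : N.Supported) (h : SimInv W st t) {p : N.Pin}
    (hd : N.Due u st (.ti p) t) : SimInv W (N.process u st (.ti p) t) t := by
  classical
  obtain ⟨x, l, hxl⟩ := Driver.isDue_iff.1 hd
  obtain ⟨-, a, ha, hat⟩ := (h.pin p).ti_pend.resolve_left (hxl ▸ List.cons_ne_nil _ _)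
  obtain ⟨b, hb, hbt, hbx, hbo⟩ :=
    exists_get?_shifter (c := N.pinShift p) ((h.file _).getLast ha).1
  obtain ⟨q, htq, hq, hprocTI⟩ := exists_procTI_eq
    (st := { st with ti := Function.update st.ti p (st.ti p).advance }) hN ha t
  rw [process, if_pos ((h.pin p).cur_advance_ne hd), hprocTI]
  refine ⟨h.nonneg, h.file, fun p' => ?_, fun C => ?_⟩
  · rcases eq_or_ne p' p with rfl | hp
    · simp only [Function.update_self, ← hbx]
      refine (h.pin p').procTI hd (h.file _).length_pos hb htq fun r => ?_
      rw [hq, hbt, hat, hbo, WithBot.coe_le_coe]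
    · simpa only [Function.update_of_ne hp] using h.pin p'
  · have hcur := Driver.cur_update (f := st.gi) (i := p) (D := (st.gi p).sched q a.x) rfl
    simpa only [hcur] using h.gate C

theorem process_gi (hW : N.IsSignals u ε W) (hm : N.MapsTo W W) (hε : 0 < ε) (h : SimInv W st t)
    {p : N.Pin} (hd : N.Due u st (.gi p) t) (hidle : N.IsIdle u st 2 t) :
    SimInv W (N.process u st (.gi p) t) t := by
  classical
  have hpin (p' : N.Pin) : PinInv (N.pinSignal W p') t (st.F (N.src p')) (st.ti p')
      (Function.update st.gi p (st.gi p).advance p') := by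
    rcases eq_or_ne p' p with rfl | hp
    · simpa only [Function.update_self] using (h.pin p').advance_gi hd
    · simpa only [Function.update_of_ne hp] using h.pin p'
  by_cases hcur : (st.gi p).advance.cur = (st.gi p).cur
  · rw [process, if_neg (not_ne_iff.2 hcur)]
    refine ⟨h.nonneg, h.file, hpin, fun C => ?_⟩
    simpa only [Driver.cur_update hcur] using h.gate C
  · rw [process, if_pos hcur, procGI_eq]
    refine ⟨h.nonneg, h.file, hpin, fun C => ?_⟩
    rcases eq_or_ne C p.1 with rfl | hC
    · have hval (p' : N.Pin) :
          (Function.update st.gi p (st.gi p).advance p').value t = (st.gi p').value t := by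
        rcases eq_or_ne p' p with rfl | hp
        · rw [Function.update_self, Driver.IsDue.value_advance hd le_rfl]
        · rw [Function.update_of_ne hp]
      simp only [Function.update_self, hval]
      exact (h.gate p.1).ensure
        (h.gateState hW hm hε le_rfl hidle (fun D => (h.file (.inr D)).le_t) p.1) _
    · have hp (I : Fin (N.channel C).d) : (⟨C, I⟩ : N.Pin) ≠ p :=
        fun hI => hC (congrArg Sigma.fst hI)
      simpa only [Function.update_of_ne hC, Function.update_of_ne (hp _)] using h.gate C

theorem process_go (hW : N.IsSignals u ε W) (hm : N.MapsTo W W) (hε : 0 < ε) (h : SimInv W st t)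
    {C : Chan} (hd : N.Due u st (.go C) t) (hidle : N.IsIdle u st 3 t) :
    SimInv W (N.process u st (.go C) t) t := by
  classical
  have hvalue : WSTState (TCTSeq.scheduled (W (.inr C))) t ((st.go C).value t) :=
    (h.gate C).value.elim (fun hv => hv ▸ h.gateState_cur hW hm hε le_rfl hidle
      (fun D => (h.file (.inr D)).le_t) C) id
  by_cases hcur : (st.go C).advance.cur = (st.go C).cur
  · rw [process, if_neg (not_ne_iff.2 hcur)]
    refine ⟨h.nonneg, h.file, h.pin, fun D => ?_⟩
    rcases eq_or_ne D C with rfl | hD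
    · simpa only [Function.update_self] using
        (h.gate D).advance hd hvalue (hcur ▸ (h.gate D).cur)
    · simpa only [Function.update_of_ne hD] using h.gate D
  · rw [(h.gate C).cur_advance hd] at hcur
    obtain ⟨c, hc, hct, hcx⟩ :=
      (h.file (.inr C)).exists_next (hW.tct _).wst (h.gate C).cur hvalue hcur
    have hadv : (st.go C).advance.cur = c.x := ((h.gate C).cur_advance hd).trans hcx.symm
    have hproc : N.process u st (.go C) t =
        { st with go := Function.update st.go C (st.go C).advance }.emit (.inr C) t c := by
      rw [process, if_pos (((h.gate C).cur_advance hd).trans_ne hcur), hadv]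
      exact procGO_eq (st := { st with go := Function.update st.go C (st.go C).advance }) hm
        (h.file _) hc hct
    rw [hproc]
    refine ⟨h.nonneg, h.file_emit hW hc hct, h.pin_emit hW hc hct, fun D => ?_⟩
    simp only [SimState.emit]
    rcases eq_or_ne D C with rfl | hD
    · simp only [Function.update_self]
      exact (h.gate D).advance hd hvalue <| by
        simp only [List.getLast?_concat, hadv, Option.map_some]
    · simpa only [Function.update_of_ne hD, Function.update_of_ne (Sum.inr_injective.ne hD)]
        using h.gate D

end SimInv

end Circuit

/-! ### Runs of the simulation -/

namespace Circuit

variable {Inp Out Chan : Type*} {N : Circuit Inp Out Chan} {u : Inp → TCTSeq} {ε : ℝ}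
  {W : Inp ⊕ Chan → TCTSeq} {st st' : N.SimState} {t τ : ℝ}

theorem initState_go (N : Circuit Inp Out Chan) (C : Chan) : N.initState.go C =
    Driver.ensure ⟨N.init (.inr C), []⟩ 0
      ((N.channel C).f fun I => (N.initState.gi ⟨C, I⟩).cur) := by
  have hvalue (x : Bool) : Driver.value ⟨x, []⟩ 0 = x := Driver.value_eq_cur fun _ he => nomatch he
  simp only [initState, Driver.ensure, hvalue, ne_comm]

theorem simInv_initState (hW : N.IsSignals u ε W) : SimInv W N.initState 0 where
  nonneg := le_rfl
  file Γ := by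
    refine ⟨Nat.one_pos, fun n a ha => ?_, fun a => hW.nonneg Γ 0 a⟩
    rw [initState, List.getElem?_singleton, Option.ite_none_right_eq_some] at ha
    obtain ⟨rfl, ha⟩ := ha
    obtain rfl := Option.some.inj ha
    exact ⟨hW.init Γ, bot_le⟩
  pin p := by
    obtain ⟨b, hb, hbt, hbx, hbo⟩ :=
      exists_get?_shifter (c := N.pinShift p) (hW.init (N.src p))
    refine ⟨.inl rfl, ⟨List.Pairwise.nil, fun _ he => nomatch he⟩, fun t' _ => ?_⟩
    have hocc : b.occ ≤ t' := by
      rw [hbo]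
      exact bot_le
    have hinit : (N.initState.gi p).value t' = b.x := hbx.symm
    rw [hinit]
    exact .succ_self hb (hbt ▸ bot_le) hocc
  gate C := by
    rw [initState_go]
    exact ⟨Driver.pend_ensure (.inl rfl) _, by rw [Driver.cur_ensure]; rfl,
      .inl (Driver.value_ensure _ _ _)⟩

/-- The invariant of a run with horizon `τ`. -/
def Inv (W : Inp ⊕ Chan → TCTSeq) (τ : ℝ) (st : N.SimState) : Prop :=
  ∃ t ≤ τ, SimInv W st t

theorem SimInv.process (hN : N.Supported) (hW : N.IsSignals u ε W) (hm : N.MapsTo W W)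
    (hε : 0 < ε) (h : SimInv W st t) {ev : N.Event} (hd : N.Due u st ev t)
    (hidle : N.IsIdle u st ev.rank t) : SimInv W (N.process u st ev t) t := by
  cases ev with
  | ext i => exact h.process_ext hW hd
  | ti p => exact h.process_ti hN hd
  | gi p => exact h.process_gi hW hm hε hd hidle
  | go C => exact h.process_go hW hm hε hd hidle

theorem Step.inv [Finite Chan] (hN : N.Supported) (hW : N.IsSignals u ε W) (hm : N.MapsTo W W)
    (hε : 0 < ε) (hs : N.Step u τ st st') (h : Inv W τ st) : Inv W τ st' := by
  obtain ⟨t₀, -, h₀⟩ := h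
  obtain ⟨ev, t, hd, htτ, hmin, rfl⟩ := hs
  have h : SimInv W st t := by
    rcases (h₀.le_of_due hW hd).eq_or_lt with rfl | hlt
    · exact h₀
    · exact h₀.advance_time hW hm hε hlt fun ev' s hs => (hmin ev' s hs).elim le_of_lt (·.1.le)
  exact ⟨t, htτ, h.process hN hW hm hε hd fun ev' s hs hr =>
    (hmin ev' s hs).resolve_right fun hle => hle.2.not_gt hr⟩

theorem Inv.of_reflTransGen [Finite Chan] (hN : N.Supported) (hW : N.IsSignals u ε W)
    (hm : N.MapsTo W W) (hε : 0 < ε) (h : Inv W τ st)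
    (hr : Relation.ReflTransGen (N.Step u τ) st st') : Inv W τ st' := by
  induction hr with
  | refl => exact h
  | tail _ hs ih => exact Step.inv hN hW hm hε hs ih

theorem Inv.length_le (h : Inv W τ st) {Γ : Inp ⊕ Chan} {k : ℕ}
    (hk : IsCutoff (TCTSeq.scheduled (W Γ)) τ k) : (st.F Γ).length ≤ k := by
  obtain ⟨t, htτ, h⟩ := h
  have hpos := (h.file Γ).length_pos
  obtain ⟨ha, hat⟩ := (h.file Γ).get? _ _ (List.getElem?_eq_getElem (Nat.sub_one_lt hpos.ne'))
  have hlt := (hk.t_le_iff ha).1 (hat.trans (WithBot.coe_le_coe.2 htτ))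
  exact Nat.le_of_pred_lt hlt

/-! ### Termination -/

/-- The termination measure, where `K Γ` bounds the length of the file of `Γ`. The signals are
ordered such that an event only schedules transitions of later ones, or adds to a file. -/
def size [Fintype Inp] [Fintype Chan] (K : Inp ⊕ Chan → ℕ) (st : N.SimState) :
    ℕ ×ₗ ℕ ×ₗ ℕ ×ₗ ℕ :=
  toLex (∑ Γ, (K Γ - (st.F Γ).length), toLex (∑ p, (st.ti p).pend.length,
    toLex (∑ p, (st.gi p).pend.length, ∑ C, (st.go C).pend.length)))

theorem sum_update_lt_sum {ι α : Type*} [Fintype ι] [DecidableEq ι] {f : ι → α} {i : ι} {a : α}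
    (w : ι → α → ℕ) (h : w i a < w i (f i)) :
    ∑ j, w j (Function.update f i a j) < ∑ j, w j (f j) := by
  refine Finset.sum_lt_sum (fun j _ => ?_) ⟨i, Finset.mem_univ i, by rwa [Function.update_self]⟩
  rcases eq_or_ne j i with rfl | hj
  · rw [Function.update_self]
    exact h.le
  · rw [Function.update_of_ne hj]

section Size

variable [Fintype Inp] [Fintype Chan] {K : Inp ⊕ Chan → ℕ}

theorem size_emit_lt {Γ : Inp ⊕ Chan} {a : Transition}
    (hK : ((st.emit Γ t a).F Γ).length ≤ K Γ) (hF : st.F = st'.F) :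
    size K (st.emit Γ t a) < size K st' := by
  classical
  refine Prod.Lex.toLex_lt_toLex.2 (.inl ?_)
  simp only [SimState.emit, Function.update_self, List.length_append, List.length_singleton] at hK
  rw [← hF]
  refine sum_update_lt_sum (fun Γ (l : List Transition) => K Γ - l.length) ?_
  rw [List.length_append, List.length_singleton]
  lia

theorem size_process_ti_lt {p : N.Pin} (hd : N.Due u st (.ti p) t) :
    size K (N.process u st (.ti p) t) < size K st := by
  classical
  have hproc : (N.process u st (.ti p) t).F = st.F ∧
      (N.process u st (.ti p) t).ti = Function.update st.ti p (st.ti p).advance := by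
    simp only [Circuit.process, SimState.procTI]
    split_ifs
    · split <;> exact ⟨rfl, rfl⟩
    · exact ⟨rfl, rfl⟩
  refine Prod.Lex.toLex_lt_toLex.2 (.inr ⟨by rw [hproc.1], Prod.Lex.toLex_lt_toLex.2 (.inl ?_)⟩)
  rw [hproc.2]
  exact sum_update_lt_sum (fun _ => List.length ∘ Driver.pend) (Driver.IsDue.length_advance_lt hd)

theorem size_process_gi_lt {p : N.Pin} (hd : N.Due u st (.gi p) t) :
    size K (N.process u st (.gi p) t) < size K st := by
  classical
  have hproc : (N.process u st (.gi p) t).F = st.F ∧ (N.process u st (.gi p) t).ti = st.ti ∧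
      (N.process u st (.gi p) t).gi = Function.update st.gi p (st.gi p).advance := by
    simp only [Circuit.process, procGI_eq]
    split_ifs <;> exact ⟨rfl, rfl, rfl⟩
  refine Prod.Lex.toLex_lt_toLex.2 (.inr ⟨by rw [hproc.1], Prod.Lex.toLex_lt_toLex.2
    (.inr ⟨by rw [hproc.2.1], Prod.Lex.toLex_lt_toLex.2 (.inl ?_)⟩)⟩)
  rw [hproc.2.2]
  exact sum_update_lt_sum (fun _ => List.length ∘ Driver.pend) (Driver.IsDue.length_advance_lt hd)

theorem size_update_go_lt [DecidableEq Chan] {C : Chan} (hd : N.Due u st (.go C) t) :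
    size K { st with go := Function.update st.go C (st.go C).advance } < size K st :=
  Prod.Lex.toLex_lt_toLex.2 (.inr ⟨rfl, Prod.Lex.toLex_lt_toLex.2 (.inr ⟨rfl,
    Prod.Lex.toLex_lt_toLex.2 (.inr ⟨rfl, sum_update_lt_sum (fun _ => List.length ∘ Driver.pend)
      (Driver.IsDue.length_advance_lt hd)⟩)⟩)⟩)

theorem size_process_lt {ev : N.Event} (hd : N.Due u st ev t)
    (hK : ∀ Γ, ((N.process u st ev t).F Γ).length ≤ K Γ) :
    size K (N.process u st ev t) < size K st := by
  classical
  cases ev with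
  | ext i =>
    obtain ⟨a, ha, -⟩ := hd
    simp only [Circuit.process, ha] at hK ⊢
    exact size_emit_lt (hK _) rfl
  | ti p => exact size_process_ti_lt hd
  | gi p => exact size_process_gi_lt hd
  | go C =>
    simp only [Circuit.process, SimState.procGO] at hK ⊢
    split_ifs at hK ⊢
    · split at hK
      · exact size_update_go_lt hd
      · exact size_emit_lt (hK _) rfl
    · exact size_update_go_lt hd

end Size

theorem Inv.acc [Finite Inp] [Finite Chan] (hN : N.Supported) (hW : N.IsSignals u ε W)
    (hm : N.MapsTo W W) (hε : 0 < ε) (h : Inv W τ st) :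
    Acc (fun st' st => N.Step u τ st st') st := by
  have := Fintype.ofFinite Inp
  have := Fintype.ofFinite Chan
  choose K hK using fun Γ => (hW.tct Γ).wst.exists_isCutoff τ
  induction hs : size K st using WellFoundedLT.induction generalizing st with
  | ind m ih =>
    refine Acc.intro st fun st' hstep => ?_
    have h' : Inv W τ st' := Step.inv hN hW hm hε hstep h
    obtain ⟨ev, t, hd, -, -, rfl⟩ := hstep
    exact ih _ (hs ▸ size_process_lt hd fun Γ => h'.length_le (hK Γ)) h' rfl

/-! ### Terminated runs -/

instance [Finite Inp] [Finite Chan] : Finite N.Event :=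
  let f : Inp ⊕ N.Pin ⊕ N.Pin ⊕ Chan → N.Event :=
    Sum.elim .ext (Sum.elim .ti (Sum.elim .gi .go))
  Finite.of_surjective f fun
    | .ext i => ⟨.inl i, rfl⟩
    | .ti p => ⟨.inr (.inl p), rfl⟩
    | .gi p => ⟨.inr (.inr (.inl p)), rfl⟩
    | .go C => ⟨.inr (.inr (.inr C)), rfl⟩

theorem Due.unique {ev : N.Event} {s s' : ℝ} (h : N.Due u st ev s) (h' : N.Due u st ev s') :
    s = s' := by
  cases ev with
  | ext i =>
    obtain ⟨a, ha, hs⟩ := h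
    obtain ⟨b, hb, hs'⟩ := h'
    obtain rfl := Option.some.inj (ha.symm.trans hb)
    exact WithBot.coe_injective (hs.symm.trans hs')
  | ti p => exact Option.some.inj (h.symm.trans h')
  | gi p => exact Option.some.inj (h.symm.trans h')
  | go C => exact Option.some.inj (h.symm.trans h')

theorem exists_step [Finite Inp] [Finite Chan] {ev : N.Event} {s : ℝ} (h : N.Due u st ev s)
    (hs : s ≤ τ) : ∃ st', N.Step u τ st st' := by
  choose! time htime using fun (ev : N.Event) (hev : ∃ s, N.Due u st ev s) => hev
  obtain ⟨ev₀, ⟨r, hr⟩, hmin⟩ := Set.exists_min_image {ev | ∃ s, N.Due u st ev s}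
    (fun ev => (toLex (time ev, ev.rank) : ℝ ×ₗ ℕ)) (Set.toFinite _) ⟨ev, s, h⟩
  have htime_eq {ev s} (h : N.Due u st ev s) : time ev = s := (htime ev ⟨s, h⟩).unique h
  have hle (ev s) (h : N.Due u st ev s) : r < s ∨ r = s ∧ ev₀.rank ≤ ev.rank := by
    simpa only [htime_eq hr, htime_eq h] using Prod.Lex.toLex_le_toLex.1 (hmin ev ⟨s, h⟩)
  exact ⟨_, ev₀, r, hr, ((hle ev s h).elim le_of_lt (·.1.le)).trans hs, hle, rfl⟩

theorem Inv.isUpTo [Finite Inp] [Finite Chan] (hW : N.IsSignals u ε W) (hm : N.MapsTo W W)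
    (hε : 0 < ε) (h : Inv W τ st) (hfinal : ∀ st', ¬ N.Step u τ st st') (Γ : Inp ⊕ Chan) :
    IsUpTo τ (W Γ) (st.F Γ) := by
  obtain ⟨t, htτ, h⟩ := h
  have hidle : N.IsIdle u st 4 τ := fun ev s hd _ =>
    not_le.1 fun hs => (exists_step hd hs).elim hfinal
  refine fun n a => ⟨fun ha => ?_, fun ⟨ha, hat⟩ => ?_⟩
  · exact ((h.file Γ).get? n a ha).imp_right (·.trans (WithBot.coe_le_coe.2 htτ))
  · have hn : n < (st.F Γ).length := by
      by_contra! hn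
      obtain ⟨b, hb⟩ := (W Γ).ge_stable hn ha
      have hba : b.t ≤ a.t :=
        (hW.tct Γ).wst.le_of_le hn (get?_scheduled_of hb) (get?_scheduled_of ha)
      exact (h.lt_t hW hm hε htτ hidle Γ b hb).not_ge (hba.trans hat)
    have hget := List.getElem?_eq_getElem hn
    rw [hget, ← ha, ((h.file Γ).get? n _ hget).1]

/-! ### Executions -/

variable (N) in
/-- The signals of all vertices, given those of input ports and channels. -/
def vertexSignal (W : Inp ⊕ Chan → TCTSeq) : Vertex Inp Out Chan → TCTSeq
  | .inp i => W (.inl i)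
  | .out o => W (N.outSrc o)
  | .chan C => W (.inr C)

theorem vertexSignal_toVertex (W : Inp ⊕ Chan → TCTSeq) (Γ : Inp ⊕ Chan) :
    N.vertexSignal W (toVertex Γ) = W Γ := by
  cases Γ <;> rfl

theorem IsSignals.isExecution (hW : N.IsSignals u ε W) (hm : N.MapsTo W W) :
    N.IsExecution (N.vertexSignal W) where
  tct
    | .inp _ => hW.tct _
    | .out _ => hW.tct _
    | .chan _ => hW.tct _
  out o := (vertexSignal_toVertex W (N.outSrc o)).symm
  chan C := by
    simp only [vertexSignal_toVertex]
    exact hm C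

theorem IsExecution.eq_vertexSignal {E : Vertex Inp Out Chan → TCTSeq} (hE : N.IsExecution E) :
    E = N.vertexSignal fun Γ => E (toVertex Γ) := by
  funext Γ
  cases Γ with
  | inp i => rfl
  | out o => exact hE.out o
  | chan C => rfl

end Circuit

end CIDM

end

theorem theorem3 {Inp Out Chan : Type*} [Finite Inp] [Finite Chan]
    (N : CIDM.Circuit Inp Out Chan) (hN : N.Supported) (hcomp : N.Compatible)
    (u : Inp → CIDM.TCTSeq) (hu : N.AdmissibleInput u) (τ : ℝ) (hτ : 0 ≤ τ) :
    -- there is no infinite run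
    Acc (fun st' st => N.Step u τ st st') N.initState ∧
    ∃ E : CIDM.Vertex Inp Out Chan → CIDM.TCTSeq,
      -- `E` is the unique execution with the given input signals
      (N.IsExecution E ∧ ∀ i, E (.inp i) = u i) ∧
      (∀ E', N.IsExecution E' → (∀ i, E' (.inp i) = u i) → E' = E) ∧
      -- every terminated run has recorded `E` up to time `τ`
      ∀ st, Relation.ReflTransGen (N.Step u τ) N.initState st →
        (∀ st', ¬ N.Step u τ st st') →
        ∀ Γ, CIDM.IsUpTo τ (E Γ) (st.recorded Γ) := by
  obtain ⟨ε, hε, hmargin⟩ := hcomp.exists_hasMargin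
  obtain ⟨W, hW, hm⟩ := CIDM.Circuit.exists_isSignals_mapsTo_self hu hε hmargin
  have hstart : CIDM.Circuit.Inv W τ N.initState := ⟨0, hτ, CIDM.Circuit.simInv_initState hW⟩
  refine ⟨hstart.acc hN hW hm hε, N.vertexSignal W, ⟨hW.isExecution hm, hW.inl⟩,
    fun E' hE' hE'u => ?_, fun st hr hfinal Γ => ?_⟩
  · have hm' : N.MapsTo (fun Γ => E' (CIDM.Circuit.toVertex Γ))
        (fun Γ => E' (CIDM.Circuit.toVertex Γ)) := hE'.chan
    rw [hE'.eq_vertexSignal,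
      CIDM.Circuit.IsSignals.eq_of_mapsTo_self (hm'.isSignals hu hmargin hE'u) hW hε hm' hm]
  · have h := (hstart.of_reflTransGen hN hW hm hε hr).isUpTo hW hm hε hfinal
    cases Γ with
    | inp i => exact h _
    | out o => exact h _
    | chan C => exact h _
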